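/- Let $G=(V,m,E,a)$ be a finite weighted directed graph: $V$ is a finite set, $m:V\to(0,\infty)$, $a:V\times V\to[0,\infty)$, and $E=\{(i,j):a(i,j)>0\}$; the edge $(i,j)$ originates at $j$ and terminates at $i$. Let $\ell^2(G)$ be the space of functions $f:V\to\mathbb C$ with inner product $\langle f,g\rangle=\sum_{x}\overline{f(x)}g(x)m(x)$. For weights $w:V\times V\to[0,\infty)$ the out-degree Laplacian is $$[L^+_w f](x)=\frac1{m(x)}\Big(\sum_{j}w(j,x)\,f(x)-\sum_{y}w(x,y)f(y)\Big).$$ Fix $\tilde E\subseteq E$, let $L^+_{\tilde E}$ and $L^+_{E\setminus\tilde E}$ be the out-degree Laplacians for the restrictions of $a$ to $\tilde E$ and to $E\setminus\tilde E$, and put $L^+_\beta=L^+_{E\setminus\tilde E}+\beta L^+_{\tilde E}$ for $\beta\in\mathbb R$. Let $\tilde E^{\intercal}=\{(i,j):(j,i)\in\tilde E\}$. A reach of $(V,\tilde E^\intercal)$ is a maximal set among the sets $\{v: v \text{ can be reached from } u \text{ by a (possibly empty) directed path in } \tilde E^\intercal\}$, $u\in V$; $\mathfrak R^\intercal$ is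 the set of these reaches. The exclusive part $H(R)$ of a reach $R$ consists of its nodes lying in no other reach, and $C(R)=R\setminus H(R)$ is its common part. For $R\in\mathfrak R^\intercal$ set: * $\omega_R(i)=\sum_T\prod_{(x,y)\in T}a(y,x)$, summed over all directed spanning trees $T\subseteq\tilde E^\intercal$ of $R$ rooted at $i$ (with $\omega_R(i)=0$ if $i\notin R$), and $\vec\gamma_R=\omega_R/\sum_k m(k)\omega_R(k)$; * $\overleftarrow{\gamma}_R:V\to\mathbb R$ is equal to $1$ on $H(R)$, equal to $0$ outside $R$, and on $C(R)$ is determined by $[(L^+_{\tilde E})^*\overleftarrow{\gamma}_R](x)=0$ for $x\in C(R)$, i.e. $\overleftarrow{\gamma}_R|_{C(R)}=-(M_{C(R)C(R)})^{-1}(M\chi_{H(R)})|_{C(R)}$ with $M$ the matrix of the adjoint $(L^+_{\tilde E})^*$ on $\ell^2(G)$; * $\underline m^+(R)=\langle\chi_R,P^+\chi_R\rangle$, where $P^+=\frac1{2\pi i}\oint_{|z|=\varepsilon}(z-L^+_{\tilde E})^{-1}dz$ is the Riesz projection onto the point $0$ of the spectrum of $L^+_{\tilde E}$ ($\varepsilon>0$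 small enough that the closed disc of radius $\varepsilon$ contains no non-zero eigenvalue); * $\underline a^+(R,S)=\Big(\sum_{r\in R,\,s\in S}\overleftarrow{\gamma}_R(r)\,a(r,s)\,\vec\gamma_S(s)\Big)\underline m^+(S)$ for $S\in\mathfrak R^\intercal$. Then $\underline m^+(R)>0$ and $\underline a^+(R,S)\ge0$ for all $R,S$, so that these data define a weighted directed graph $\underline G^+$ with node set $\mathfrak R^\intercal$; let $\underline L^+$ be its out-degree Laplacian on $\ell^2(\underline G^+)$. Define $J^+_\downarrow:\ell^2(G)\to\ell^2(\underline G^+)$ and $J^+_\uparrow:\ell^2(\underline G^+)\to\ell^2(G)$ by $$[J^+_\downarrow f](R)=\frac{\langle\overleftarrow{\gamma}_R,f\rangle_{\ell^2(G)}}{\underline m^+(R)},\qquad J^+_\uparrow\underline f=\sum_{R\in\mathfrak R^\intercal}\underline m^+(R)\,\underline f(R)\,\vec\gamma_R .$$ For every $t>0$, in the operator norm of $\ell^2(G)$, $$\big\|e^{-tL^+_\beta}-J^+_\uparrow e^{-t\underline L^+}J^+_\downarrow\big\|\longrightarrow0\qquad\text{as }\beta\to\infty .$$ -/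

import Mathlib

open Filter Topology

/-- A finite weighted directed graph: positive node masses `m` and nonnegative edge weights `a`.
The pair `(i, j)` is an edge iff `0 < a i j`; it originates at `j` and terminates at `i`. -/
structure WeightedDigraph (V : Type*) where
  m : V → ℝ
  m_pos : ∀ v, 0 < m v
  a : V → V → ℝ
  a_nonneg : ∀ v w, 0 ≤ a v w

/-! ### Reachability and reaches of `(V, F)` -/

section Reaches

variable {V : Type*}

/-- The edge set of the transposed graph. -/
def transposeEdges (F : Set (V × V)) : Set (V × V) := {e | (e.2, e.1) ∈ F}

/-- There is an edge of `F` originating at `u` and terminating at `v`. -/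
def EdgeFromTo (F : Set (V × V)) (u v : V) : Prop := (v, u) ∈ F

/-- All nodes that can be reached from `u` along a (possibly empty) directed path in `F`. -/
def reachableFrom (F : Set (V × V)) (u : V) : Set V :=
  {v | Relation.ReflTransGen (EdgeFromTo F) u v}

/-- A reach of `(V, F)`: a maximal reachable set. -/
def IsReach (F : Set (V × V)) (R : Set V) : Prop :=
  Maximal (fun S : Set V => ∃ u, S = reachableFrom F u) R

/-- The set of reaches of `(V, F)`. -/
def Reach (F : Set (V × V)) : Type _ := {R : Set V // IsReach F R}

noncomputable instance [Fintype V] (F : Set (V × V)) : Fintype (Reach F) :=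
  @Fintype.ofFinite _ (inferInstanceAs (Finite {R : Set V // IsReach F R}))

/-- The exclusive part of a reach: its nodes that lie in no other reach. -/
def exclusivePart (F : Set (V × V)) (R : Reach F) : Set V :=
  {v | v ∈ R.1 ∧ ∀ S : Reach F, S ≠ R → v ∉ S.1}

/-- The common part of a reach: its nodes that also lie in some other reach. -/
def commonPart (F : Set (V × V)) (R : Reach F) : Set V :=
  {v | v ∈ R.1 ∧ ∃ S : Reach F, S ≠ R ∧ v ∈ S.1}

/-- `T` is (the edge set of) a directed spanning tree, rooted at `i`, of the subgraph of `(V, F)`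
induced on `R`: no edge enters the root, exactly one edge enters every other node of `R`, and
every node of `R` is reached from the root along `T`. -/
def IsSpanningTree (F : Set (V × V)) (R : Set V) (i : V) (T : Finset (V × V)) : Prop :=
  i ∈ R ∧ (∀ e ∈ T, e ∈ F ∧ e.1 ∈ R ∧ e.2 ∈ R) ∧ (∀ e ∈ T, e.1 ≠ i) ∧
    (∀ v ∈ R, v ≠ i → ∃! u, (v, u) ∈ T) ∧
    ∀ v ∈ R, Relation.ReflTransGen (EdgeFromTo (T : Set (V × V))) i v

open Classical in
/-- The weight vector of a reach, `ω_R(i) = ∑_T ∏_{(x,y) ∈ T} w(x,y)`, the sum running over all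
spanning trees `T` of `R` rooted at `i`. -/
noncomputable def weightVector [Fintype V] (w : V → V → ℝ) (F : Set (V × V)) (R : Reach F)
    (i : V) : ℝ :=
  ∑ T : Finset (V × V) with IsSpanningTree F R.1 i T, ∏ e ∈ T, w e.1 e.2

end Reaches

/-! ### The Riesz projection onto the point `0` of the spectrum -/

section Riesz

variable {E : Type*} [NormedAddCommGroup E] [NormedSpace ℂ E] [FiniteDimensional ℂ E]

theorem exists_isolating_radius (B : E →L[ℂ] E) :
    ∃ ε : ℝ, 0 < ε ∧ Metric.closedBall (0 : ℂ) ε ∩ spectrum ℂ B ⊆ {0} := by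
  have h1 : (spectrum ℂ B).Finite := by
    refine (Module.End.finite_spectrum (B : E →ₗ[ℂ] E)).subset fun z hz h => hz ?_
    rw [spectrum.mem_resolventSet_iff] at h ⊢
    obtain ⟨u, hu⟩ := h
    refine ⟨⟨algebraMap ℂ _ z - B, LinearMap.toContinuousLinearMap (u⁻¹ : (E →ₗ[ℂ] E)ˣ).1,
      ?_, ?_⟩, rfl⟩
    · ext x
      have := LinearMap.congr_fun u.mul_inv x
      rw [hu] at this
      exact this
    · ext x
      have := LinearMap.congr_fun u.inv_mul x
      rw [hu] at this
      exact this
  have h2 : (spectrum ℂ B \ {0})ᶜ ∈ 𝓝 (0 : ℂ) :=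
    (h1.subset Set.sdiff_subset).isClosed.isOpen_compl.mem_nhds (by simp)
  obtain ⟨ε, hε, h⟩ := Metric.nhds_basis_closedBall.mem_iff.1 h2
  refine ⟨ε, hε, fun z hz => ?_⟩
  by_contra h0
  exact h hz.1 ⟨hz.2, h0⟩

/-- The Riesz projection `(2πi)⁻¹ ∮_{|z| = ε} (z - B)⁻¹ dz` onto `0`, where the closed disc of
radius `ε` contains no point of the spectrum of `B` other than (possibly) `0`. -/
noncomputable def rieszProjection (B : E →L[ℂ] E) : E →L[ℂ] E :=
  (2 * Real.pi * Complex.I : ℂ)⁻¹ •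
    ∮ z in C(0, (exists_isolating_radius B).choose), resolvent B z

end Riesz

namespace WeightedDigraph

variable {V : Type*}

/-- The edge set `E`, i.e. the support of the weight function. -/
def edges (G : WeightedDigraph V) : Set (V × V) := {e | 0 < G.a e.1 e.2}

/-! ### The Hilbert space `ℓ²(G)` -/

/-- `ℓ²(G)`: complex functions on the nodes, with inner product
`⟨f, g⟩ = ∑ x, conj (f x) * g x * m x`. -/
def Ell2 (_G : WeightedDigraph V) : Type _ := V → ℂ

instance (G : WeightedDigraph V) : AddCommGroup G.Ell2 := inferInstanceAs (AddCommGroup (V → ℂ))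

instance (G : WeightedDigraph V) : Module ℂ G.Ell2 := inferInstanceAs (Module ℂ (V → ℂ))

instance [Fintype V] (G : WeightedDigraph V) : FiniteDimensional ℂ G.Ell2 :=
  inferInstanceAs (FiniteDimensional ℂ (V → ℂ))

/-- The positive definite Hermitian form of `ℓ²(G)`. -/
@[reducible]
noncomputable def ell2Core [Fintype V] (G : WeightedDigraph V) :
    InnerProductSpace.Core ℂ G.Ell2 where
  inner f g := ∑ x, (starRingEnd ℂ) (f x) * g x * (G.m x : ℂ)
  conj_inner_symm f g := by
    simp only [map_sum, map_mul, Complex.conj_conj, Complex.conj_ofReal]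
    exact Finset.sum_congr rfl fun x _ => by ring
  re_inner_nonneg f := by
    simp only [map_sum]
    refine Finset.sum_nonneg fun x _ => ?_
    rw [← Complex.normSq_eq_conj_mul_self, ← Complex.ofReal_mul]
    exact mul_nonneg (Complex.normSq_nonneg _) (G.m_pos x).le
  add_left f g h := by
    rw [← Finset.sum_add_distrib]
    refine Finset.sum_congr rfl fun x _ => ?_
    rw [show (f + g) x = f x + g x from rfl, map_add]
    ring
  smul_left f g c := by
    rw [Finset.mul_sum]
    refine Finset.sum_congr rfl fun x _ => ?_
    rw [show (c • f) x = c * f x from rfl, map_mul]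
    ring
  definite f hf := by
    have h1 : ∑ x, Complex.normSq (f x) * G.m x = 0 := by
      have : ((∑ x, Complex.normSq (f x) * G.m x : ℝ) : ℂ) = 0 := by
        rw [← hf]
        push_cast
        exact Finset.sum_congr rfl fun x _ => by rw [Complex.normSq_eq_conj_mul_self]
      exact_mod_cast this
    have h2 := (Finset.sum_eq_zero_iff_of_nonneg fun x _ =>
      mul_nonneg (Complex.normSq_nonneg (f x)) (G.m_pos x).le).1 h1
    funext x
    have h3 := h2 x (Finset.mem_univ x)
    exact Complex.normSq_eq_zero.1 ((mul_eq_zero.1 h3).resolve_right (G.m_pos x).ne')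

noncomputable instance [Fintype V] (G : WeightedDigraph V) : NormedAddCommGroup G.Ell2 :=
  @InnerProductSpace.Core.toNormedAddCommGroup ℂ G.Ell2 _ _ _ G.ell2Core

noncomputable instance [Fintype V] (G : WeightedDigraph V) : InnerProductSpace ℂ G.Ell2 :=
  InnerProductSpace.ofCore G.ell2Core.toCore

/-- The characteristic function of a set of nodes, as an element of `ℓ²(G)`. -/
noncomputable def chi (G : WeightedDigraph V) (S : Set V) : G.Ell2 :=
  Set.indicator S (fun _ => (1 : ℂ))

/-! ### Out-degree Laplacians -/

section Laplacian

variable [Fintype V]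

/-- The out-degree Laplacian for the node masses of `G` and edge weights `w`:
`f ↦ (1 / m x) * ((∑ j, w j x) * f x - ∑ y, w x y * f y)`. -/
noncomputable def outLaplacianWith (G : WeightedDigraph V) (w : V → V → ℝ) :
    G.Ell2 →L[ℂ] G.Ell2 :=
  LinearMap.toContinuousLinearMap
    { toFun := fun f x =>
        (1 / (G.m x : ℂ)) * ((∑ j, (w j x : ℂ)) * f x - ∑ y, (w x y : ℂ) * f y)
      map_add' := fun f g => by
        funext x
        change _ * (_ * (f x + g x) - ∑ y, (w x y : ℂ) * (f y + g y)) = _ + _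
        simp only [mul_add, Finset.sum_add_distrib]
        ring
      map_smul' := fun c f => by
        funext x
        change _ * (_ * (c * f x) - ∑ y, (w x y : ℂ) * (c * f y)) = c * _
        simp only [mul_left_comm _ c, ← Finset.mul_sum]
        ring }

/-- The out-degree Laplacian `L⁺` of `G`. -/
noncomputable def outLaplacian (G : WeightedDigraph V) : G.Ell2 →L[ℂ] G.Ell2 :=
  G.outLaplacianWith G.a

open Classical in
/-- The weight function of `G` restricted to the edges in `F`. -/
noncomputable def restrictWeight (G : WeightedDigraph V) (F : Set (V × V)) (x y : V) : ℝ :=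
  if (x, y) ∈ F then G.a x y else 0

/-- The out-degree Laplacian `L⁺_F` of the subgraph with edge set `F`. -/
noncomputable def outLaplacianOn (G : WeightedDigraph V) (F : Set (V × V)) :
    G.Ell2 →L[ℂ] G.Ell2 :=
  G.outLaplacianWith (G.restrictWeight F)

/-- `L⁺_β = L⁺_{E \ F} + β L⁺_F`. -/
noncomputable def outLaplacianCoupled (G : WeightedDigraph V) (F : Set (V × V)) (β : ℝ) :
    G.Ell2 →L[ℂ] G.Ell2 :=
  G.outLaplacianOn (G.edges \ F) + (β : ℂ) • G.outLaplacianOn F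

end Laplacian

/-! ### Kernel vectors of `L⁺_F`, indexed by the reaches of the transposed graph -/

section Kernels

variable [Fintype V] (G : WeightedDigraph V) (F : Set (V × V))

/-- The right kernel vector of `L⁺_F` attached to a reach `R` of the transpose of `(V, F)`: the
multiple of the weight vector of `R` that satisfies `∑ j, ⟨e_j, γ⟩ = ∑ j, m j * γ j = 1`. -/
noncomputable def gammaRight (R : Reach (transposeEdges F)) (j : V) : ℝ :=
  weightVector (fun x y => G.a y x) (transposeEdges F) R j /
    ∑ k, G.m k * weightVector (fun x y => G.a y x) (transposeEdges F) R k

open Classical in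
/-- The matrix of the in-degree Laplacian of the transpose of `(V, F)`, which is the adjoint of
`L⁺_F` in `ℓ²(G)`. -/
noncomputable def inLaplacianTranspose : Matrix V V ℝ :=
  Matrix.of fun x y =>
    (1 / G.m x) * ((if x = y then ∑ i, G.restrictWeight F i x else 0) - G.restrictWeight F y x)

/-- The block of the matrix `inLaplacianTranspose` on the common part of a reach. -/
noncomputable def commonBlock (R : Reach (transposeEdges F)) :
    Matrix (commonPart (transposeEdges F) R) (commonPart (transposeEdges F) R) ℝ :=
  (G.inLaplacianTranspose F).submatrix Subtype.val Subtype.val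

open Classical in
/-- The left kernel vector of `L⁺_F` attached to a reach `R` of the transpose of `(V, F)`: it is
`1` on the exclusive part `H` of `R`, it vanishes outside `R`, and on the common part `C` it is
`-(M_{CC})⁻¹ (M χ_H)_C`, where `M` is the matrix of the adjoint of `L⁺_F`; that is, on `C` it
solves `M γ = 0`. -/
noncomputable def gammaLeft (R : Reach (transposeEdges F)) (j : V) : ℝ :=
  if j ∈ exclusivePart (transposeEdges F) R then 1
  else if hj : j ∈ commonPart (transposeEdges F) R then
    -((G.commonBlock F R)⁻¹.mulVec
        (fun x => ∑ y with y ∈ exclusivePart (transposeEdges F) R,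
          G.inLaplacianTranspose F x.1 y) ⟨j, hj⟩)
  else 0

end Kernels

/-! ### The reduced graph and the operators `J⁺↓`, `J⁺↑` -/

section Reduced

variable [Fintype V] (G : WeightedDigraph V) (F : Set (V × V))

/-- The mass `⟨χ_R, P⁺ χ_R⟩` of a reach, with `P⁺` the Riesz projection onto the point `0` of the
spectrum of `L⁺_F` (this number is real). -/
noncomputable def reducedMass (R : Reach (transposeEdges F)) : ℝ :=
  (inner ℂ (G.chi R.1) (rieszProjection (G.outLaplacianOn F) (G.chi R.1))).re

open Classical in
/-- The reduced edge weights
`(∑_{r ∈ R, s ∈ S} γLeft_R r * a r s * γRight_S s) * reducedMass S`. -/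
noncomputable def reducedWeight (R S : Reach (transposeEdges F)) : ℝ :=
  (∑ r with r ∈ R.1, ∑ s with s ∈ S.1, G.gammaLeft F R r * G.a r s * G.gammaRight F S s) *
    G.reducedMass F S

variable (hm : ∀ R, 0 < G.reducedMass F R) (ha : ∀ R S, 0 ≤ G.reducedWeight F R S)

/-- The reduced graph: its nodes are the reaches of the transpose of `(V, F)`. -/
noncomputable def reducedGraph : WeightedDigraph (Reach (transposeEdges F)) where
  m := G.reducedMass F
  m_pos := hm
  a := G.reducedWeight F
  a_nonneg := ha

/-- `J⁺↓ : f ↦ (R ↦ ⟨γLeft_R, f⟩ / reducedMass R)`. -/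
noncomputable def projectDown : G.Ell2 →L[ℂ] (G.reducedGraph F hm ha).Ell2 :=
  LinearMap.toContinuousLinearMap
    { toFun := fun f R =>
        inner ℂ (show G.Ell2 from fun v => (G.gammaLeft F R v : ℂ)) f / (G.reducedMass F R : ℂ)
      map_add' := fun f g => by
        funext R
        change inner ℂ _ (f + g) / _ = inner ℂ _ f / _ + inner ℂ _ g / _
        rw [inner_add_right, add_div]
      map_smul' := fun c f => by
        funext R
        change inner ℂ _ (c • f) / _ = c * (inner ℂ _ f / _)
        rw [inner_smul_right, mul_div_assoc] }

/-- `J⁺↑ : f ↦ ∑ R, reducedMass R * f R * γRight_R`. -/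
noncomputable def interpolateUp : (G.reducedGraph F hm ha).Ell2 →L[ℂ] G.Ell2 :=
  LinearMap.toContinuousLinearMap
    { toFun := fun f v => ∑ R, (G.reducedMass F R : ℂ) * f R * (G.gammaRight F R v : ℂ)
      map_add' := fun f g => by
        funext v
        change ∑ R, _ * (f R + g R) * _ = ∑ R, _ + ∑ R, _
        rw [← Finset.sum_add_distrib]
        exact Finset.sum_congr rfl fun R _ => by ring
      map_smul' := fun c f => by
        funext v
        change ∑ R, _ * (c * f R) * _ = c * ∑ R, _
        rw [Finset.mul_sum]
        exact Finset.sum_congr rfl fun R _ => by ring }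

end Reduced

end WeightedDigraph

/-! ### Poisson averages of a power-bounded operator. -/

section Poisson

variable {A : Type*} [NormedRing A] [NormedAlgebra ℂ A] [CompleteSpace A]

/-! Write `L₀`, `L₁` for the Laplacians of `E \ F` and of `F`, put `L_β = L₀ + β L₁` and `U(t) = exp
(-t L_β)`. The proof separates an operator limit from the combinatorial description of the kernel of
`L₁`.

Operator limit. The out-degree Laplacian conserves total mass, so `L_β = (1 + β) c (1 - K)` with `K`
a contraction for the weighted `ℓ¹` norm, hence power bounded in `ℓ²` uniformly in `β`. Since `exp
(s (K - 1))` is a Poisson average of the powers of `K`, `U` is bounded uniformly in `β`, and `L_β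
U(t)` is only of order `√β`, because a Poisson variable of mean `s` fluctuates by `√s`. Let `P`
satisfy `L₁ P = 0` and `1 - P = L₁ Z`. Then `U (1 - P) = β⁻¹ (U L_β - U L₀) Z = O(β^(-1/2))`, so the
fast part dies. On the range of `P`, a Duhamel comparison with the compressed semigroup, corrected
by a term of order `1/β`, has error `O(1/β)` (`tendsto_exp_strong_coupling`). No information on the
nonzero spectrum of `L₁` is needed.

Kernel. A maximum principle (`nonpos_of_subharmonic`) shows that functions annihilated by the
adjoint of `L₁` are determined by their values at one root of each reach, so the `gammaLeft` span
them. The Markov chain tree theorem (`sum_mul_treeSum`) shows that the tree sums, hence the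
`gammaRight`, are annihilated by `L₁`. They live on roots, where each `gammaLeft` is `0` or `1`, so
the two families are biorthogonal. The resulting oblique projection is `J⁺↑ J⁺↓`; by the Fredholm
alternative it is an admissible `P`, and it is the Riesz projection. Its explicit form gives the
reduced masses, and `∑ R, gammaLeft R = 1` identifies the compression of `L₀` with the reduced
Laplacian. -/

theorem hasSum_poisson (s : ℝ) :
    HasSum (fun n : ℕ => Real.exp (-s) * (s ^ n / n.factorial)) 1 := by
  have h := (NormedSpace.expSeries_div_hasSum_exp (𝔸 := ℝ) s).mul_left (Real.exp (-s))
  rwa [← Real.exp_eq_exp_ℝ, ← Real.exp_add, neg_add_cancel, Real.exp_zero] at h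

theorem poisson_succ {s : ℝ} (hs : s ≠ 0) (n : ℕ) :
    Real.exp (-s) * (s ^ (n + 1) / (n + 1).factorial) * ((n + 1 : ℕ) / s) =
      Real.exp (-s) * (s ^ n / n.factorial) := by
  have : (n.factorial : ℝ) ≠ 0 := by positivity
  have h2 : (n : ℝ) + 1 ≠ 0 := by positivity
  rw [Nat.factorial_succ]
  push_cast
  field_simp
  ring

theorem hasSum_poisson_mean {s : ℝ} (hs : s ≠ 0) :
    HasSum (fun n : ℕ => Real.exp (-s) * (s ^ n / n.factorial) * (n / s)) 1 := by
  rw [← hasSum_nat_add_iff' 1]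
  simpa only [poisson_succ hs, Finset.sum_range_one, Nat.cast_zero, zero_div, mul_zero, sub_zero]
    using hasSum_poisson s

theorem hasSum_poisson_sq {s : ℝ} (hs : s ≠ 0) :
    HasSum (fun n : ℕ => Real.exp (-s) * (s ^ n / n.factorial) * (n / s) ^ 2) (1 + 1 / s) := by
  rw [← hasSum_nat_add_iff' 1]
  have h := (hasSum_poisson_mean hs).add ((hasSum_poisson s).mul_right (1 / s))
  rw [one_mul] at h
  simp only [Finset.sum_range_one, Nat.cast_zero, zero_div, ne_eq, OfNat.ofNat_ne_zero,
    not_false_eq_true, zero_pow, mul_zero, sub_zero]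
  refine (congrArg (fun f => HasSum f _) (funext fun n => ?_)).mpr h
  rw [pow_two, ← mul_assoc, poisson_succ hs]
  push_cast
  ring

/-- The variance of a Poisson variable of mean `s`, divided by `s ^ 2`. It is the source of the `1 /
√s` decay below. -/
theorem hasSum_poisson_variance {s : ℝ} (hs : s ≠ 0) :
    HasSum (fun n : ℕ => Real.exp (-s) * (s ^ n / n.factorial) * (1 - n / s) ^ 2) (1 / s) := by
  have h := ((hasSum_poisson s).add (hasSum_poisson_sq hs)).sub ((hasSum_poisson_mean hs).mul_left 2)
  rw [show 1 + (1 + 1 / s) - 2 * 1 = 1 / s by ring] at h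
  refine (congrArg (fun f => HasSum f _) (funext fun n => ?_)).mpr h
  ring

/-- Scalars commute with `K`, so the factor `exp (-s)` splits off, and the exponential series of `s
K` becomes an average with Poisson weights. -/
theorem hasSum_exp_smul_sub_one (K : A) (s : ℝ) :
    HasSum (fun n : ℕ => ((Real.exp (-s) * (s ^ n / n.factorial) : ℝ) : ℂ) • K ^ n)
      (NormedSpace.exp ((s : ℂ) • (K - 1))) := by
  have h1 : (s : ℂ) • (K - 1) = algebraMap ℂ A (-(s : ℂ)) + (s : ℂ) • K := by
    rw [Algebra.algebraMap_eq_smul_one, smul_sub, neg_smul]; abel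
  have h2 : NormedSpace.exp ((s : ℂ) • (K - 1)) =
      Complex.exp (-(s : ℂ)) • NormedSpace.exp ((s : ℂ) • K) := by
    let : NormedAlgebra ℚ A := NormedAlgebra.restrictScalars ℚ ℂ A
    rw [h1, NormedSpace.exp_add_of_commute (Algebra.commutes _ _),
      ← NormedSpace.algebraMap_exp_comm, Complex.exp_eq_exp_ℂ,
      Algebra.smul_def (NormedSpace.exp (-(s : ℂ)))]
  rw [h2]
  have h := (NormedSpace.exp_series_hasSum_exp' (𝕂 := ℂ) ((s : ℂ) • K)).const_smul (Complex.exp (-(s : ℂ)))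
  convert h using 2 with n
  rw [smul_pow, smul_smul, smul_smul]
  congr 1
  push_cast
  ring

theorem norm_exp_smul_sub_one_le {K : A} {C : ℝ} (hK : ∀ n, ‖K ^ n‖ ≤ C) {s : ℝ} (hs : 0 ≤ s) :
    ‖NormedSpace.exp ((s : ℂ) • (K - 1))‖ ≤ C := by
  have h := (hasSum_poisson s).mul_right C
  rw [one_mul] at h
  refine (hasSum_exp_smul_sub_one K s).norm_le_of_bounded h fun n => ?_
  rw [norm_smul, Complex.norm_real, Real.norm_of_nonneg (by positivity)]
  gcongr
  exact hK n

/-- Decay of the derivative of the semigroup generated by `K - 1`, for `K` power bounded. -/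
theorem norm_one_sub_mul_exp_le {K : A} {C : ℝ} (hK : ∀ n, ‖K ^ n‖ ≤ C) {s : ℝ} (hs : 0 < s) :
    ‖(1 - K) * NormedSpace.exp ((s : ℂ) • (K - 1))‖ ≤ C / √s := by
  have hU := hasSum_exp_smul_sub_one K s
  -- Multiplication by `K` shifts the index, and the Poisson weights satisfy `p (n + 1) * ((n + 1) /
  -- s) = p n`. Hence `1 - K` multiplies the `n`-th coefficient by `1 - n / s`.
  have h1 : HasSum (fun n : ℕ =>
      ((Real.exp (-s) * (s ^ n / n.factorial) * (n / s) : ℝ) : ℂ) • K ^ n)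
      (K * NormedSpace.exp ((s : ℂ) • (K - 1))) := by
    rw [← hasSum_nat_add_iff' 1]
    simp only [poisson_succ hs.ne', Finset.sum_range_one, Nat.cast_zero, zero_div, mul_zero,
      sub_zero, Complex.ofReal_zero, zero_smul]
    refine (congrArg (fun f => HasSum f _) (funext fun n => ?_)).mpr (hU.mul_left K)
    rw [mul_smul_comm, pow_succ']
  have h2 := hU.sub h1
  have h3 : (1 - K) * NormedSpace.exp ((s : ℂ) • (K - 1)) =
      NormedSpace.exp ((s : ℂ) • (K - 1)) - K * NormedSpace.exp ((s : ℂ) • (K - 1)) := by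
    rw [sub_mul, one_mul]
  rw [h3]
  have hq : 0 < √s := Real.sqrt_pos.2 hs
  have h4 := (((hasSum_poisson s).mul_left ((√s)⁻¹ / 2)).add
    ((hasSum_poisson_variance hs.ne').mul_left (√s / 2))).mul_left C
  have h5 : C * ((√s)⁻¹ / 2 * 1 + √s / 2 * (1 / s)) = C / √s := by
    have : s = √s * √s := (Real.mul_self_sqrt hs.le).symm
    rw [this, Real.sqrt_mul_self hq.le]
    field_simp
    ring
  rw [h5] at h4
  refine h2.norm_le_of_bounded h4 fun n => ?_
  rw [← sub_smul, norm_smul, ← Complex.ofReal_sub, Complex.norm_real, Real.norm_eq_abs]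
  set p := Real.exp (-s) * (s ^ n / n.factorial) with hp
  have hp0 : 0 ≤ p := by positivity
  set d : ℝ := 1 - n / s
  have e1 : p - p * (n / s) = p * d := by ring
  have hC : 0 ≤ C := (norm_nonneg _).trans (hK 0)
  -- AM-GM in place of Cauchy-Schwarz. The weights are balanced so that total mass `1` and variance
  -- `1 / s` each contribute half of `1 / √s`.
  have hd : |d| ≤ (√s)⁻¹ / 2 + √s / 2 * d ^ 2 := by
    have h6 : (√s)⁻¹ / 2 + √s / 2 * d ^ 2 - |d| = (√s)⁻¹ / 2 * (√s * |d| - 1) ^ 2 := by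
      rw [← sq_abs d]
      field_simp
      ring
    have : 0 ≤ (√s)⁻¹ / 2 * (√s * |d| - 1) ^ 2 := by positivity
    linarith
  rw [e1, abs_mul, abs_of_nonneg hp0]
  calc p * |d| * ‖K ^ n‖ ≤ p * ((√s)⁻¹ / 2 + √s / 2 * d ^ 2) * C := by
        gcongr
        exact hK n
    _ = _ := by ring

end Poisson

/-! ### The strong coupling limit for abstract operators. -/

section Semigroup

theorem hasDerivAt_exp_neg_ofReal_smul {A : Type*} [NormedRing A] [NormedAlgebra ℂ A]
    [CompleteSpace A] (x : A) (s : ℝ) :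
    HasDerivAt (fun r : ℝ => NormedSpace.exp (-(r : ℂ) • x))
      (-(x * NormedSpace.exp (-(s : ℂ) • x))) s := by
  have h1 := hasDerivAt_exp_smul_const' (𝕂 := ℂ) (-x) (s : ℂ)
  have h2 := h1.scomp s Complex.ofRealCLM.hasDerivAt
  simpa [Function.comp_def] using h2

variable {E E' : Type*} [NormedAddCommGroup E] [NormedSpace ℂ E] [CompleteSpace E]
  [NormedAddCommGroup E'] [NormedSpace ℂ E'] [CompleteSpace E']

/-- Strong coupling limit of a semigroup: if `L₁` annihilates the range of `up` and
`1 - up ∘ down` factors through `L₁`, then `exp (-t (L₀ + β L₁))` converges to the semigroup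
generated by the compression `down ∘ L₀ ∘ up`. -/
theorem tendsto_exp_strong_coupling (L₀ L₁ Z : E →L[ℂ] E) (up : E' →L[ℂ] E) (down : E →L[ℂ] E')
    (hup : L₁.comp up = 0) (hZ : 1 - up.comp down = L₁ * Z) {C c : ℝ} (hc : 0 < c)
    (hK : ∀ β : ℝ, 0 ≤ β → ∃ K : E →L[ℂ] E, (∀ n, ‖K ^ n‖ ≤ C) ∧
      L₀ + (β : ℂ) • L₁ = (((1 + β) * c : ℝ) : ℂ) • (1 - K))
    {t : ℝ} (ht : 0 < t) :
    Tendsto (fun β : ℝ => ‖NormedSpace.exp (-(t : ℂ) • (L₀ + (β : ℂ) • L₁)) -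
      up.comp ((NormedSpace.exp (-(t : ℂ) • (down.comp (L₀.comp up)))).comp down)‖)
      atTop (𝓝 0) := by
  set Y : E' →L[ℂ] E' := down.comp (L₀.comp up) with hY
  set W : ℝ → (E →L[ℂ] E) :=
    fun s => up.comp ((NormedSpace.exp (-(s : ℂ) • Y)).comp down) with hW
  set U : ℝ → ℝ → (E →L[ℂ] E) :=
    fun β s => NormedSpace.exp (-(s : ℂ) • (L₀ + (β : ℂ) • L₁)) with hU
  set P : E →L[ℂ] E := up.comp down with hP
  have hUle : ∀ β, 0 ≤ β → ∀ s, 0 ≤ s → ‖U β s‖ ≤ C := by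
    intro β hβ s hs
    obtain ⟨K, hKn, hKe⟩ := hK β hβ
    have h := norm_exp_smul_sub_one_le hKn (s := s * ((1 + β) * c)) (by positivity)
    have e : U β s = NormedSpace.exp (((s * ((1 + β) * c) : ℝ) : ℂ) • (K - 1)) := by
      simp only [hU, hKe]
      congr 1
      rw [smul_smul, ← neg_sub K 1, smul_neg, ← neg_smul]
      congr 1
      push_cast
      ring
    rwa [e]
  -- The generator has size of order `β`, but the decay at Poisson time `t (1 + β) c` leaves only
  -- `√β`, which the factor `β⁻¹` below absorbs.
  have hLU : ∀ β : ℝ, 0 ≤ β → ‖(L₀ + (β : ℂ) • L₁) * U β t‖ ≤ C * √((1 + β) * c) / √t := by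
    intro β hβ
    obtain ⟨K, hKn, hKe⟩ := hK β hβ
    have hpos : 0 < (1 + β) * c := by positivity
    have h := norm_one_sub_mul_exp_le hKn (s := t * ((1 + β) * c)) (by positivity)
    have e : U β t = NormedSpace.exp (((t * ((1 + β) * c) : ℝ) : ℂ) • (K - 1)) := by
      simp only [hU, hKe]
      congr 1
      rw [smul_smul, ← neg_sub K 1, smul_neg, ← neg_smul]
      congr 1
      push_cast
      ring
    rw [e, hKe, smul_mul_assoc, norm_smul, Complex.norm_real, Real.norm_of_nonneg hpos.le]
    calc (1 + β) * c * _ ≤ (1 + β) * c * (C / √(t * ((1 + β) * c))) := by gcongr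
      _ = C * √((1 + β) * c) / √t := by
        rw [Real.sqrt_mul ht.le]
        have h1 : 0 < √((1 + β) * c) := Real.sqrt_pos.2 hpos
        have h2 : 0 < √t := Real.sqrt_pos.2 ht
        have h3 := Real.mul_self_sqrt hpos.le
        field_simp
        rw [pow_two, h3]
        ring
  have hcomm : ∀ β : ℝ, Commute (L₀ + (β : ℂ) • L₁) (U β t) := fun β =>
    ((Commute.refl _).smul_right _).exp_right
  -- the part of the semigroup on the range of `L₁` vanishes
  have hfast : ∀ β : ℝ, 0 < β → ‖U β t * (1 - P)‖ ≤
      β⁻¹ * (C * √((1 + β) * c) / √t + C * ‖L₀‖) * ‖Z‖ := by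
    intro β hβ
    -- Replace `1 - P` by `L₁ Z` and solve `L_β = L₀ + β L₁` for `L₁`.
    have e1 : U β t * (1 - P) =
        (β : ℂ)⁻¹ • (((L₀ + (β : ℂ) • L₁) * U β t - U β t * L₀) * Z) := by
      rw [hZ, (hcomm β).eq, mul_add, add_sub_cancel_left, mul_smul_comm, smul_mul_assoc, smul_smul,
        inv_mul_cancel₀ (by exact_mod_cast hβ.ne'), one_smul, mul_assoc]
    rw [e1, norm_smul, norm_inv, Complex.norm_real, Real.norm_of_nonneg hβ.le, mul_assoc]
    gcongr
    refine (norm_mul_le _ _).trans ?_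
    gcongr
    refine (norm_sub_le _ _).trans (add_le_add (hLU β hβ.le) ((norm_mul_le _ _).trans ?_))
    gcongr
    exact hUle β hβ.le t ht.le
  -- the slow part
  set Φ : (E' →L[ℂ] E') →L[ℂ] (E →L[ℂ] E) :=
    (ContinuousLinearMap.compL ℂ E E' E up).comp ((ContinuousLinearMap.compL ℂ E E' E').flip down)
    with hΦ
  have hWd : ∀ s, HasDerivAt W (-(P * L₀ * W s)) s := by
    intro s
    have h := (Φ.restrictScalars ℝ).hasFDerivAt.comp_hasDerivAt s
      (hasDerivAt_exp_neg_ofReal_smul Y s)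
    have h' : HasDerivAt W (Φ (-(Y * NormedSpace.exp (-(s : ℂ) • Y)))) s := h
    refine h'.congr_deriv ?_
    rw [map_neg]
    rfl
  have hWc : Continuous W := continuous_iff_continuousAt.2 fun s => (hWd s).continuousAt
  have hL₁W : ∀ s, L₁ * W s = 0 := by
    intro s
    change L₁.comp (up.comp _) = 0
    rw [← ContinuousLinearMap.comp_assoc, hup, ContinuousLinearMap.zero_comp]
  set Q : E →L[ℂ] E := Z * L₀ * P * L₀ - L₀ * Z * L₀ with hQ
  obtain ⟨B, hB⟩ := (isCompact_Icc (a := (0 : ℝ)) (b := t)).exists_bound_of_continuousOn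
    (f := fun s => Q * W s) (by fun_prop)
  have hW0 : W 0 = P := by
    simp only [hW, Complex.ofReal_zero, neg_zero, zero_smul, NormedSpace.exp_zero]
    rfl
  have hslow : ∀ β : ℝ, 0 < β → ‖U β t * P - W t‖ ≤
      β⁻¹ * (C * B * t + ‖Z * L₀ * W t‖ + C * ‖Z * L₀ * P‖) := by
    intro β hβ
    have hβ' : (β : ℂ) ≠ 0 := by exact_mod_cast hβ.ne'
    -- Duhamel interpolation with a corrector. Without `β⁻¹ Z L₀ W` the derivative would contain `(1
    -- - P) L₀ W`, which is not small. Since `L₁ Z = 1 - P`, applying `β L₁` to the corrector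
    -- cancels this term and leaves `β⁻¹ U Q W`.
    set D : ℝ → (E →L[ℂ] E) :=
      fun s => U β (t - s) * (W s - (β : ℂ)⁻¹ • (Z * L₀ * W s)) with hD
    have hDd : ∀ s, HasDerivAt D ((β : ℂ)⁻¹ • (U β (t - s) * (Q * W s))) s := by
      intro s
      have h1 := (hasDerivAt_exp_neg_ofReal_smul (L₀ + (β : ℂ) • L₁) (t - s)).scomp s
        ((hasDerivAt_id s).const_sub t)
      have h2 := (hWd s).sub ((((hWd s).const_mul (Z * L₀))).const_smul (β : ℂ)⁻¹)
      have h3 := h1.mul h2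
      have h4 : HasDerivAt D (((-1 : ℝ) •
            -((L₀ + (β : ℂ) • L₁) * U β (t - s))) * (W s - (β : ℂ)⁻¹ • (Z * L₀ * W s)) +
          U β (t - s) * (-(P * L₀ * W s) - (β : ℂ)⁻¹ • (Z * L₀ * -(P * L₀ * W s)))) s := h3
      refine h4.congr_deriv ?_
      have hc' : (L₀ + (β : ℂ) • L₁) * U β (t - s) = U β (t - s) * (L₀ + (β : ℂ) • L₁) :=
        ((Commute.refl _).smul_right _).exp_right.eq
      rw [neg_smul, one_smul, neg_neg, hc', mul_assoc (U β (t - s)), ← mul_add, ← mul_smul_comm (β : ℂ)⁻¹ (U β (t - s))]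
      congr 1
      have e2 : L₁ * (Z * L₀ * W s) = L₀ * W s - P * L₀ * W s := by
        rw [mul_assoc Z, ← mul_assoc L₁, ← hZ, sub_mul, one_mul, mul_assoc P]
      simp only [add_mul, mul_sub, smul_mul_assoc, mul_smul_comm, hL₁W, smul_zero, e2, hQ, sub_mul,
        smul_sub, smul_add, inv_smul_smul₀ hβ']
      simp only [mul_neg, smul_neg, mul_assoc]
      abel
    have hb : ∀ s ∈ Set.Ico (0 : ℝ) t, ‖(β : ℂ)⁻¹ • (U β (t - s) * (Q * W s))‖ ≤ β⁻¹ * (C * B) := by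
      intro s hs
      rw [norm_smul, norm_inv, Complex.norm_real, Real.norm_of_nonneg hβ.le]
      gcongr
      refine (norm_mul_le _ _).trans ?_
      have h1 := hUle β hβ.le (t - s) (by linarith [hs.2])
      have h2 := hB s ⟨hs.1, hs.2.le⟩
      exact mul_le_mul h1 h2 (norm_nonneg _) ((norm_nonneg _).trans h1)
    have hmv := norm_image_sub_le_of_norm_deriv_le_segment' (fun s _ => (hDd s).hasDerivWithinAt) hb
      t ⟨ht.le, le_rfl⟩
    have hDt : D t = W t - (β : ℂ)⁻¹ • (Z * L₀ * W t) := by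
      simp [hD, hU, NormedSpace.exp_zero]
    have hD0 : D 0 = U β t * P - (β : ℂ)⁻¹ • (U β t * (Z * L₀ * P)) := by
      simp only [hD, sub_zero, hW0, mul_sub, mul_smul_comm]
    have e3 : U β t * P - W t = -(D t - D 0) - (β : ℂ)⁻¹ • (Z * L₀ * W t) +
        (β : ℂ)⁻¹ • (U β t * (Z * L₀ * P)) := by
      rw [hDt, hD0]; abel
    rw [e3]
    refine (norm_add_le _ _).trans ?_
    rw [mul_add]
    refine add_le_add ((norm_sub_le _ _).trans ?_) ?_
    · rw [mul_add, norm_neg]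
      refine add_le_add (hmv.trans (le_of_eq (by ring))) (le_of_eq ?_)
      rw [norm_smul, norm_inv, Complex.norm_real, Real.norm_of_nonneg hβ.le]
    · rw [norm_smul, norm_inv, Complex.norm_real, Real.norm_of_nonneg hβ.le]
      gcongr
      refine (norm_mul_le _ _).trans ?_
      gcongr
      exact hUle β hβ.le t ht.le
  have hlim : Tendsto (fun β : ℝ => β⁻¹ * (C * √((1 + β) * c) / √t + C * ‖L₀‖) * ‖Z‖ +
      β⁻¹ * (C * B * t + ‖Z * L₀ * W t‖ + C * ‖Z * L₀ * P‖)) atTop (𝓝 0) := by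
    have h1 : Tendsto (fun β : ℝ => β⁻¹) atTop (𝓝 0) := tendsto_inv_atTop_zero
    have h2 : Tendsto (fun β : ℝ => √(β⁻¹ * ((β⁻¹ + 1) * c))) atTop (𝓝 0) := by
      have h := (h1.mul ((h1.add_const 1).mul_const c)).sqrt
      simpa using h
    have h3 : Tendsto (fun β : ℝ => β⁻¹ * √((1 + β) * c)) atTop (𝓝 0) := by
      refine h2.congr' ?_
      filter_upwards [eventually_gt_atTop 0] with β hβ
      have : β⁻¹ * ((β⁻¹ + 1) * c) = (β⁻¹) ^ 2 * ((1 + β) * c) := by field_simp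
      rw [this, Real.sqrt_mul (by positivity), Real.sqrt_sq (by positivity)]
    have h4 := ((((h3.mul_const (C / √t)).add (h1.mul_const (C * ‖L₀‖))).mul_const ‖Z‖)).add
      (h1.mul_const (C * B * t + ‖Z * L₀ * W t‖ + C * ‖Z * L₀ * P‖))
    simp only [zero_mul, add_zero] at h4
    refine h4.congr fun β => ?_
    ring
  refine squeeze_zero' (Eventually.of_forall fun β => norm_nonneg _) ?_ hlim
  filter_upwards [eventually_gt_atTop 0] with β hβ
  have e : U β t - W t = U β t * (1 - P) + (U β t * P - W t) := by
    rw [mul_sub, mul_one]; abel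
  change ‖U β t - W t‖ ≤ _
  rw [e]
  exact (norm_add_le _ _).trans (add_le_add (hfast β hβ) (hslow β hβ))

end Semigroup

/-! ### Identification of the Riesz projection. -/

section Riesz

variable {E : Type*} [NormedAddCommGroup E] [NormedSpace ℂ E] [FiniteDimensional ℂ E]

theorem ContinuousLinearMap.isUnit_of_mul_eq_one {X Y : E →L[ℂ] E} (h : X * Y = 1) : IsUnit X := by
  have h1 : (X : E →ₗ[ℂ] E) * (Y : E →ₗ[ℂ] E) = 1 := by
    ext v
    exact congrArg (fun T : E →L[ℂ] E => T v) h
  have h2 : (Y : E →ₗ[ℂ] E) * (X : E →ₗ[ℂ] E) = 1 := mul_eq_one_comm.1 h1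
  refine ⟨⟨X, Y, h, ?_⟩, rfl⟩
  ext v
  exact LinearMap.congr_fun h2 v

/-- If `P` is a projection that annihilates `L` from both sides and `1 - P` factors through `L`,
then `P` is the Riesz projection of `L` onto `0`. -/
theorem rieszProjection_eq {L P Z : E →L[ℂ] E} (hPP : P * P = P) (hLP : L * P = 0)
    (hPL : P * L = 0) (hZ : 1 - P = L * Z) : rieszProjection L = P := by
  have : CompleteSpace E := FiniteDimensional.complete ℂ E
  unfold rieszProjection
  set ε := (exists_isolating_radius L).choose with hε
  obtain ⟨hε0, hsp⟩ := (exists_isolating_radius L).choose_spec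
  rw [← hε] at hε0 hsp
  have hP1 : P * (1 - P) = 0 := by rw [mul_sub, mul_one, hPP, sub_self]
  have hU : ∀ z ∈ Metric.closedBall (0 : ℂ) ε, z ≠ 0 → IsUnit (algebraMap ℂ (E →L[ℂ] E) z - L) := by
    intro z hz hz0
    by_contra h
    exact hz0 (hsp ⟨hz, h⟩)
  have hinv : ∀ z ∈ Metric.closedBall (0 : ℂ) ε, z ≠ 0 →
      (algebraMap ℂ (E →L[ℂ] E) z - L) * resolvent L z = 1 := fun z hz hz0 =>
    Ring.mul_inverse_cancel _ (hU z hz hz0)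
  have hinv' : ∀ z ∈ Metric.closedBall (0 : ℂ) ε, z ≠ 0 →
      resolvent L z * (algebraMap ℂ (E →L[ℂ] E) z - L) = 1 := fun z hz hz0 =>
    Ring.inverse_mul_cancel _ (hU z hz hz0)
  have hRP : ∀ z ∈ Metric.closedBall (0 : ℂ) ε, z ≠ 0 → resolvent L z * P = z⁻¹ • P := by
    intro z hz hz0
    have h1 : (algebraMap ℂ (E →L[ℂ] E) z - L) * (z⁻¹ • P) = P := by
      rw [mul_smul_comm, sub_mul, hLP, sub_zero, ← Algebra.smul_def, smul_smul,
        inv_mul_cancel₀ hz0, one_smul]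
    calc resolvent L z * P = resolvent L z * ((algebraMap ℂ (E →L[ℂ] E) z - L) * (z⁻¹ • P)) := by
          rw [h1]
      _ = _ := by rw [← mul_assoc, hinv' z hz hz0, one_mul]
  have hPR : ∀ z ∈ Metric.closedBall (0 : ℂ) ε, z ≠ 0 → P * resolvent L z = z⁻¹ • P := by
    intro z hz hz0
    have h1 : (z⁻¹ • P) * (algebraMap ℂ (E →L[ℂ] E) z - L) = P := by
      rw [smul_mul_assoc, mul_sub, hPL, sub_zero, ← Algebra.commutes, ← Algebra.smul_def, smul_smul,
        inv_mul_cancel₀ hz0, one_smul]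
    calc P * resolvent L z = ((z⁻¹ • P) * (algebraMap ℂ (E →L[ℂ] E) z - L)) * resolvent L z := by
          rw [h1]
      _ = _ := by rw [mul_assoc, hinv z hz hz0, mul_one]
  -- Any point outside the closed disc would do: `L' = L + c P` moves the eigenvalue `0` of `L` to
  -- `c`, so `L'` has no spectrum in the disc. The resolvent of `L` is then `z⁻¹ P` plus a
  -- holomorphic term, which Cauchy's theorem removes from the integral.
  set c : ℂ := ((ε + 1 : ℝ) : ℂ) with hc
  have hcn : ‖c‖ = ε + 1 := by
    rw [hc, Complex.norm_real, Real.norm_of_nonneg (by positivity)]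
  have hc0 : c ≠ 0 := by
    rw [← norm_pos_iff, hcn]; positivity
  have hcz : ∀ z ∈ Metric.closedBall (0 : ℂ) ε, z - c ≠ 0 := by
    intro z hz h
    rw [sub_eq_zero] at h
    rw [mem_closedBall_zero_iff, h, hcn] at hz
    linarith
  set L' : E →L[ℂ] E := L + c • P with hL'
  have hunit : ∀ z ∈ Metric.closedBall (0 : ℂ) ε, z ∈ resolventSet ℂ L' := by
    intro z hz
    by_cases hz0 : z = 0
    · subst hz0
      -- At `z = 0` the resolvent of `L` may not exist; `Z` inverts `L` on the complement of the
      -- range of `P`, and `c⁻¹` inverts `L'` on that range.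
      refine ContinuousLinearMap.isUnit_of_mul_eq_one (Y := -((1 - P) * Z + c⁻¹ • P)) ?_
      rw [map_zero, zero_sub, neg_mul_neg, hL', add_mul, mul_add, mul_add, ← mul_assoc, mul_sub, hLP,
        smul_mul_assoc c P ((1 - P) * Z), ← mul_assoc P, hP1, zero_mul, mul_smul_comm, hLP,
        smul_mul_smul_comm, hPP, mul_inv_cancel₀ hc0]
      simp only [mul_one, sub_zero, smul_zero, add_zero, zero_add, one_smul]
      rw [← hZ]
      abel
    · refine ContinuousLinearMap.isUnit_of_mul_eq_one
        (Y := resolvent L z * (1 - P) + (z - c)⁻¹ • P) ?_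
      have e : algebraMap ℂ (E →L[ℂ] E) z - L' = (algebraMap ℂ (E →L[ℂ] E) z - L) - c • P := by
        rw [hL']; abel
      have e2 : (algebraMap ℂ (E →L[ℂ] E) z - L - c • P) * P = (z - c) • P := by
        rw [sub_mul, sub_mul, hLP, smul_mul_assoc, hPP, sub_zero, ← Algebra.smul_def, sub_smul]
      rw [e, mul_add, mul_smul_comm, e2, smul_smul, inv_mul_cancel₀ (hcz z hz), one_smul, ← mul_assoc,
        sub_mul _ (c • P), hinv z hz hz0, smul_mul_assoc, hPR z hz hz0, sub_mul, one_mul,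
        smul_mul_assoc, smul_mul_assoc, hP1]
      simp
  have hdec : ∀ z ∈ Metric.sphere (0 : ℂ) ε,
      resolvent L z = z⁻¹ • P + resolvent L' z * (1 - P) := by
    intro z hz
    have hz' := Metric.sphere_subset_closedBall hz
    have hz0 : z ≠ 0 := by
      rintro rfl
      rw [mem_sphere_zero_iff_norm, norm_zero] at hz
      exact hε0.ne hz
    have h1 : resolvent L' z * (algebraMap ℂ (E →L[ℂ] E) z - L') = 1 :=
      Ring.inverse_mul_cancel _ (hunit z hz')
    have h2 : (algebraMap ℂ (E →L[ℂ] E) z - L') * (resolvent L z * (1 - P)) = 1 - P := by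
      have e : algebraMap ℂ (E →L[ℂ] E) z - L' = (algebraMap ℂ (E →L[ℂ] E) z - L) - c • P := by
        rw [hL']; abel
      rw [e, ← mul_assoc, sub_mul, hinv z hz' hz0, smul_mul_assoc, hPR z hz' hz0, sub_mul, one_mul,
        smul_mul_assoc, smul_mul_assoc, hP1]
      simp
    have h3 : resolvent L z * (1 - P) = resolvent L' z * (1 - P) := by
      calc resolvent L z * (1 - P)
          = resolvent L' z * ((algebraMap ℂ (E →L[ℂ] E) z - L') * (resolvent L z * (1 - P))) := by
            rw [← mul_assoc, h1, one_mul]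
        _ = _ := by rw [h2]
    rw [← h3, mul_sub, mul_one, hRP z hz' hz0]
    abel
  have hdiff : ∀ z ∈ Metric.closedBall (0 : ℂ) ε,
      DifferentiableAt ℂ (fun z => resolvent L' z * (1 - P)) z := fun z hz =>
    (spectrum.hasDerivAt_resolvent_const_left (hunit z hz)).differentiableAt.mul_const _
  have hcont : ContinuousOn (fun z => resolvent L' z * (1 - P)) (Metric.closedBall (0 : ℂ) ε) :=
    fun z hz => (hdiff z hz).continuousAt.continuousWithinAt
  have hzero : (∮ z in C(0, ε), resolvent L' z * (1 - P)) = 0 :=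
    Complex.circleIntegral_eq_zero_of_differentiable_on_off_countable hε0.le Set.countable_empty
      hcont fun z hz => hdiff z (Metric.ball_subset_closedBall hz.1)
  have hci1 : CircleIntegrable (fun z : ℂ => z⁻¹ • P) 0 ε := by
    refine ContinuousOn.circleIntegrable hε0.le fun z hz => ?_
    have hz0 : z ≠ 0 := by
      rintro rfl
      rw [mem_sphere_zero_iff_norm, norm_zero] at hz
      exact hε0.ne hz
    exact ((continuousAt_inv₀ hz0).smul continuousAt_const).continuousWithinAt
  have hci2 : CircleIntegrable (fun z => resolvent L' z * (1 - P)) 0 ε :=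
    (hcont.mono Metric.sphere_subset_closedBall).circleIntegrable hε0.le
  rw [circleIntegral.integral_congr hε0.le hdec, circleIntegral.integral_add hci1 hci2, hzero,
    add_zero, circleIntegral.integral_smul_const]
  have h5 : (∮ z in C(0, ε), (z : ℂ)⁻¹) = 2 * Real.pi * Complex.I := by
    have := circleIntegral.integral_sub_center_inv (0 : ℂ) hε0.ne'
    simpa using this
  rw [h5, smul_smul, inv_mul_cancel₀ Complex.two_pi_I_ne_zero, one_smul]

end Riesz

/-! ### The Markov chain tree theorem. -/

section RootedMaps

variable {α : Type*}

/-- Up to its first visit to `z`, an orbit never uses the value of the map at `z`. -/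
theorem exists_iterate_update_eq [DecidableEq α] {f : α → α} {z c v : α} (h : ∃ n, f^[n] v = z) :
    ∃ n, (Function.update f z c)^[n] v = z := by
  obtain ⟨n, hn⟩ := h
  induction n generalizing v with
  | zero => exact ⟨0, hn⟩
  | succ n ih =>
    by_cases hv : v = z
    · exact ⟨0, hv⟩
    · obtain ⟨k, hk⟩ := ih (v := f v) hn
      refine ⟨k + 1, ?_⟩
      rw [Function.iterate_succ_apply, Function.update_of_ne hv]
      exact hk

/-- Both `a` and `b` lie on the cycle through `x`, and a map is injective on its periodic points. -/
theorem eq_of_map_eq_of_iterate {h : α → α} {x a b : α} (ha : h a = x) (hb : h b = x)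
    (ha' : ∃ n, h^[n] x = a) (hb' : ∃ n, h^[n] x = b) : a = b := by
  have key : ∀ c, h c = x → (∃ n, h^[n] x = c) → c ∈ Function.periodicPts h := by
    rintro c hc ⟨n, rfl⟩
    refine ⟨n + 1, n.succ_pos, ?_⟩
    change h^[n + 1] (h^[n] x) = h^[n] x
    rw [Function.iterate_succ_apply, hc]
  exact (Function.bijOn_periodicPts h).injOn (key a ha ha') (key b hb hb') (ha.trans hb.symm)

/-- A spanning tree of the complete directed graph on `α` rooted at `i`, given by its parent map:
the map fixes `i` and all its orbits run into `i`. -/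
def IsRootedMap (i : α) (g : α → α) : Prop := g i = i ∧ ∀ v, ∃ n, g^[n] v = i

/-- If every vertex can be reached from `i`, there is a spanning tree rooted at `i`. -/
theorem exists_isRootedMap {r : α → α → Prop} {i : α} (h : ∀ v, Relation.ReflTransGen r i v) :
    ∃ g : α → α, IsRootedMap i g ∧ ∀ v, v ≠ i → r (g v) v := by
  classical
  -- `S n` collects the endpoints of walks of length exactly `n` from `i`. A breadth-first tree
  -- arises by choosing for each vertex a parent whose least such `n` is strictly smaller.
  obtain ⟨S, hS0, hSs⟩ : ∃ S : ℕ → Set α, S 0 = {i} ∧ ∀ n, S (n + 1) = {v | ∃ u ∈ S n, r u v} :=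
    ⟨fun n => Nat.rec {i} (fun _ T => {v | ∃ u ∈ T, r u v}) n, rfl, fun _ => rfl⟩
  have hS : ∀ v, ∃ n, v ∈ S n := by
    intro v
    induction h v with
    | refl => exact ⟨0, hS0 ▸ rfl⟩
    | tail _ hr ih => exact ⟨ih.choose + 1, hSs _ ▸ ⟨_, ih.choose_spec, hr⟩⟩
  have hp : ∀ v : α, v ≠ i → ∃ u : α, r u v ∧ Nat.find (hS u) < Nat.find (hS v) := by
    intro v hv
    have h1 := Nat.find_spec (hS v)
    rcases hn : Nat.find (hS v) with _ | n
    · rw [hn, hS0] at h1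
      exact absurd h1 hv
    · rw [hn, hSs] at h1
      obtain ⟨u, hu, hr⟩ := h1
      exact ⟨u, hr, Nat.lt_succ_of_le (Nat.find_min' (hS u) hu)⟩
  choose p hpr hpl using hp
  refine ⟨fun v => if hv : v = i then i else p v hv, ⟨by simp, fun v => ?_⟩, fun v hv => ?_⟩
  · induction hn : Nat.find (hS v) using Nat.strong_induction_on generalizing v with
    | _ n ih =>
      by_cases hv : v = i
      · exact ⟨0, hv⟩
      · obtain ⟨k, hk⟩ := ih _ (hn ▸ hpl v hv) (p v hv) rfl
        exact ⟨k + 1, by rw [Function.iterate_succ_apply, dif_neg hv, hk]⟩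
  · simpa only [dif_neg hv] using hpr v hv

variable [Fintype α]

open Classical in
/-- The sum of the weights of all spanning trees rooted at `i`. -/
noncomputable def treeSum (w : α → α → ℝ) (i : α) : ℝ :=
  ∑ g : α → α with IsRootedMap i g, ∏ v ∈ Finset.univ.erase i, w v (g v)

-- The right-hand side runs over maps whose only cycle passes through `x` and is not a loop.
-- Deleting the value at `x` leaves a tree rooted at `x` together with the deleted edge.
open Classical in
theorem sum_out_mul_treeSum (w : α → α → ℝ) (x : α) :
    (∑ y ∈ Finset.univ.erase x, w x y) * treeSum w x =
      ∑ h : α → α with h x ≠ x ∧ ∀ v, ∃ n, h^[n] v = x, ∏ v, w v (h v) := by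
  rw [treeSum, Finset.sum_mul_sum, ← Finset.sum_product']
  refine Finset.sum_bij' (fun p _ => Function.update p.2 x p.1)
    (fun h _ => (h x, Function.update h x x)) ?_ ?_ ?_ ?_ ?_
  · rintro ⟨y, g⟩ hp
    simp only [Finset.mem_product, Finset.mem_erase, Finset.mem_univ, and_true, Finset.mem_filter,
      true_and] at hp ⊢
    refine ⟨by simpa using hp.1, fun v => exists_iterate_update_eq (hp.2.2 v)⟩
  · intro h hh
    simp only [Finset.mem_product, Finset.mem_erase, Finset.mem_univ, and_true, Finset.mem_filter,
      true_and] at hh ⊢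
    exact ⟨hh.1, by simp, fun v => exists_iterate_update_eq (hh.2 v)⟩
  · rintro ⟨y, g⟩ hp
    simp only [Finset.mem_product, Finset.mem_erase, Finset.mem_univ, and_true, Finset.mem_filter,
      true_and] at hp
    have : Function.update g x x = g := by
      conv_rhs => rw [← Function.update_eq_self x g, hp.2.1]
    simp [this]
  · intro h _
    simp
  · rintro ⟨y, g⟩ hp
    rw [← Finset.mul_prod_erase _ _ (Finset.mem_univ x)]
    simp only [Function.update_self]
    congr 1
    refine Finset.prod_congr rfl fun v hv => ?_
    rw [Function.update_of_ne (Finset.ne_of_mem_erase hv)]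

-- The same maps as in `sum_out_mul_treeSum`, cut at the other end: deleting the cycle edge that
-- enters `x` leaves a tree rooted at the predecessor `z` of `x` on the cycle. Uniqueness of that
-- predecessor makes the correspondence injective.
open Classical in
theorem sum_in_mul_treeSum (w : α → α → ℝ) (x : α) :
    ∑ z ∈ Finset.univ.erase x, w z x * treeSum w z =
      ∑ h : α → α with h x ≠ x ∧ ∀ v, ∃ n, h^[n] v = x, ∏ v, w v (h v) := by
  simp only [treeSum, Finset.mul_sum]
  rw [Finset.sum_sigma']
  refine Finset.sum_bij (fun p _ => Function.update p.2 p.1 x) ?_ ?_ ?_ ?_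
  · rintro ⟨z, g⟩ hp
    simp only [Finset.mem_sigma, Finset.mem_erase, Finset.mem_univ, and_true, Finset.mem_filter,
      true_and] at hp ⊢
    obtain ⟨hzx, hgz, hg⟩ := hp
    refine ⟨?_, fun v => ?_⟩
    · rw [Function.update_of_ne hzx.symm]
      intro hx
      obtain ⟨n, hn⟩ := hg x
      rw [Function.iterate_fixed hx] at hn
      exact hzx hn.symm
    · obtain ⟨n, hn⟩ := exists_iterate_update_eq (c := x) (hg v)
      refine ⟨n + 1, ?_⟩
      rw [Function.iterate_succ_apply', hn, Function.update_self]
  · rintro ⟨z, g⟩ hp ⟨z', g'⟩ hp' he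
    simp only [Finset.mem_sigma, Finset.mem_erase, Finset.mem_univ, and_true, Finset.mem_filter,
      true_and] at hp hp' he
    obtain ⟨hzx, hgz, hg⟩ := hp
    obtain ⟨hzx', hgz', hg'⟩ := hp'
    have hz : z = z' := by
      refine eq_of_map_eq_of_iterate (h := Function.update g z x) (x := x)
        (Function.update_self _ _ _) ?_ (exists_iterate_update_eq (hg x)) ?_
      · rw [he, Function.update_self]
      · rw [he]
        exact exists_iterate_update_eq (hg' x)
    subst hz
    have hgg : g = g' := by
      funext v
      by_cases hv : v = z
      · rw [hv, hgz, hgz']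
      · have := congrFun he v
        rwa [Function.update_of_ne hv, Function.update_of_ne hv] at this
    rw [hgg]
  · intro h hh
    simp only [Finset.mem_univ, Finset.mem_filter, true_and] at hh
    obtain ⟨hx, hh⟩ := hh
    obtain ⟨p, hp⟩ := hh (h x)
    -- The orbit of `h x` returns to `x` after `p` steps, so `h^[p] x` is the last point of the
    -- cycle before `x`.
    set z := h^[p] x with hz
    have hzx : h z = x := by
      rw [hz, ← Function.iterate_succ_apply' h, Function.iterate_succ_apply, hp]
    refine ⟨⟨z, Function.update h z z⟩, ?_, ?_⟩
    · simp only [Finset.mem_sigma, Finset.mem_erase, Finset.mem_univ, and_true, Finset.mem_filter,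
        true_and]
      refine ⟨?_, by simp, fun v => exists_iterate_update_eq ?_⟩
      · intro h0
        rw [h0] at hzx
        exact hx hzx
      · obtain ⟨n, hn⟩ := hh v
        exact ⟨p + n, by rw [Function.iterate_add_apply, hn]⟩
    · simp only [Function.update_idem]
      conv_rhs => rw [← Function.update_eq_self z h, hzx]
  · rintro ⟨z, g⟩ hp
    rw [← Finset.mul_prod_erase _ _ (Finset.mem_univ z)]
    simp only [Function.update_self]
    congr 1
    refine Finset.prod_congr rfl fun v hv => ?_
    rw [Function.update_of_ne (Finset.ne_of_mem_erase hv)]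

/-- The Markov chain tree theorem. -/
theorem sum_mul_treeSum (w : α → α → ℝ) (x : α) :
    (∑ y, w x y) * treeSum w x = ∑ z, w z x * treeSum w z := by
  classical
  rw [← Finset.add_sum_erase _ _ (Finset.mem_univ x), add_mul, sum_out_mul_treeSum,
    ← sum_in_mul_treeSum, Finset.add_sum_erase _ (fun z => w z x * treeSum w z) (Finset.mem_univ x)]

theorem treeSum_pos {w : α → α → ℝ} (hw : ∀ x y, 0 ≤ w x y) {i : α}
    (h : ∀ v, Relation.ReflTransGen (fun u v => 0 < w v u) i v) : 0 < treeSum w i := by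
  classical
  obtain ⟨g, hg, hgw⟩ := exists_isRootedMap h
  refine Finset.sum_pos' (fun _ _ => Finset.prod_nonneg fun _ _ => hw _ _)
    ⟨g, by simpa using hg, Finset.prod_pos fun v hv => hgw v (Finset.ne_of_mem_erase hv)⟩

theorem treeSum_ne_zero_imp {w : α → α → ℝ} {i : α} (h : treeSum w i ≠ 0) (v : α) :
    Relation.ReflTransGen (fun u v => w v u ≠ 0) i v := by
  classical
  obtain ⟨g, hg, hne⟩ := Finset.exists_ne_zero_of_sum_ne_zero h
  simp only [Finset.mem_filter, Finset.mem_univ, true_and] at hg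
  obtain ⟨n, hn⟩ := hg.2 v
  induction n generalizing v with
  | zero => rw [show v = i from hn]
  | succ n ih =>
    by_cases hv : v = i
    · rw [hv]
    · exact (ih (g v) hn).tail
        ((Finset.prod_ne_zero_iff.1 hne) v (Finset.mem_erase.2 ⟨hv, Finset.mem_univ v⟩))

end RootedMaps

/-! ### Reaches, their roots and their spanning trees. -/

section Reaches

variable {V : Type*} {T : Set (V × V)}

theorem mem_reachableFrom_self (T : Set (V × V)) (u : V) : u ∈ reachableFrom T u :=
  Relation.ReflTransGen.refl

theorem reachableFrom_subset {u v : V} (h : v ∈ reachableFrom T u) :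
    reachableFrom T v ⊆ reachableFrom T u := fun _ hw => Relation.ReflTransGen.trans h hw

/-- `u` is a root of the reach `R`: every node of `R` can be reached from `u`. -/
def Reach.IsRoot (R : Reach T) (u : V) : Prop := R.1 = reachableFrom T u

theorem Reach.exists_isRoot (R : Reach T) : ∃ u, R.IsRoot u := R.2.prop

/-- A chosen root of a reach. -/
noncomputable def Reach.root (R : Reach T) : V := R.exists_isRoot.choose

theorem Reach.isRoot_root (R : Reach T) : R.IsRoot R.root := R.exists_isRoot.choose_spec

theorem Reach.IsRoot.mem {R : Reach T} {u : V} (h : R.IsRoot u) : u ∈ R.1 := by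
  rw [h]
  exact mem_reachableFrom_self T u

theorem Reach.mem_of_reachable {R : Reach T} {u v : V} (hu : u ∈ R.1)
    (h : v ∈ reachableFrom T u) : v ∈ R.1 := by
  obtain ⟨r, hr⟩ := R.exists_isRoot
  rw [hr] at hu ⊢
  exact reachableFrom_subset hu h

theorem Reach.isRoot_of_subset {R : Reach T} {u : V} (h : R.1 ⊆ reachableFrom T u) : R.IsRoot u :=
  R.2.eq_of_le ⟨u, rfl⟩ h

theorem Reach.IsRoot.of_reachable {R : Reach T} {u v : V} (hu : R.IsRoot u)
    (h : u ∈ reachableFrom T v) : R.IsRoot v :=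
  Reach.isRoot_of_subset (hu.le.trans (reachableFrom_subset h))

/-- `S` is closed under reachability, so it contains all of `R`, and `R` is maximal. Thus roots are
exclusive to their reach, which underlies the biorthogonality of the kernel vectors. -/
theorem Reach.IsRoot.eq_of_mem {R S : Reach T} {u : V} (hu : R.IsRoot u) (h : u ∈ S.1) :
    S = R := by
  refine Subtype.ext (R.2.eq_of_le S.2.prop ?_).symm
  rw [hu]
  exact fun v hv => Reach.mem_of_reachable h hv

theorem Reach.IsRoot.mem_exclusivePart {R : Reach T} {u : V} (hu : R.IsRoot u) :
    u ∈ exclusivePart T R :=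
  ⟨hu.mem, fun _ hS h => hS (hu.eq_of_mem h)⟩

theorem exists_reach_mem [Finite V] (T : Set (V × V)) (v : V) : ∃ R : Reach T, v ∈ R.1 := by
  obtain ⟨R, hR, hmax⟩ := Finite.exists_le_maximal
    (p := fun S : Set V => ∃ u, S = reachableFrom T u) (a := reachableFrom T v) ⟨v, rfl⟩
  exact ⟨⟨R, hmax⟩, hR (mem_reachableFrom_self T v)⟩

theorem disjoint_exclusivePart_commonPart (R : Reach T) {v : V} (h : v ∈ exclusivePart T R) :
    v ∉ commonPart T R := fun ⟨_, S, hS, hv⟩ => h.2 S hS hv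

theorem mem_exclusivePart_or_commonPart (R : Reach T) {v : V} (h : v ∈ R.1) :
    v ∈ exclusivePart T R ∨ v ∈ commonPart T R := by
  by_cases h' : ∃ S : Reach T, S ≠ R ∧ v ∈ S.1
  · exact Or.inr ⟨h, h'⟩
  · exact Or.inl ⟨h, fun S hS hv => h' ⟨S, hS, hv⟩⟩

theorem exclusivePart_of_edge [Finite V] {R : Reach T} {u v : V} (h : EdgeFromTo T u v)
    (hv : v ∈ exclusivePart T R) : u ∈ exclusivePart T R := by
  have key : ∀ S : Reach T, u ∈ S.1 → S = R := by
    intro S hS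
    by_contra hne
    exact hv.2 S hne (Reach.mem_of_reachable hS (Relation.ReflTransGen.single h))
  obtain ⟨S, hS⟩ := exists_reach_mem T u
  exact ⟨key S hS ▸ hS, fun S hne hS => hne (key S hS)⟩

section Trees

variable [Fintype V]

-- A tree edge `(v, u)` enters `v`, and each non-root has exactly one entering edge, so an edge set
-- of this kind is the graph of a parent map `v ↦ u` away from the root. Edges outside `T` get
-- weight `0`, which discards the other maps.
open Classical in
theorem weightVector_eq_treeSum (w : V → V → ℝ) (R : Reach T) (i : R.1) :
    weightVector w T R i = treeSum (fun x y : R.1 => if (x.1, y.1) ∈ T then w x y else 0) i := by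
  have h0 : treeSum (fun x y : R.1 => if (x.1, y.1) ∈ T then w x y else 0) i =
      ∑ g : R.1 → R.1 with IsRootedMap i g ∧ ∀ v, v ≠ i → (v.1, (g v).1) ∈ T,
        ∏ v ∈ Finset.univ.erase i, w v (g v) := by
    rw [treeSum, ← Finset.filter_filter]
    conv_rhs => rw [Finset.sum_filter]
    refine Finset.sum_congr (by ext; simp) fun g _ => ?_
    split_ifs with h
    · exact Finset.prod_congr (by ext; simp) fun v hv => if_pos (h v (Finset.ne_of_mem_erase hv))
    · push Not at h
      obtain ⟨v, hv, hT⟩ := h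
      exact Finset.prod_eq_zero (i := v) (by simp [hv]) (if_neg hT)
  rw [h0, weightVector]
  symm
  have hmem : ∀ (g : R.1 → R.1) (e : V × V), e ∈ (Finset.univ.erase i).image
      (fun v : R.1 => (v.1, (g v).1)) ↔ ∃ v : R.1, v ≠ i ∧ (v.1, (g v).1) = e := by
    intro g e
    simp
  refine Finset.sum_bij (fun g _ => (Finset.univ.erase i).image fun v : R.1 => (v.1, (g v).1))
    ?_ ?_ ?_ ?_
  · intro g hg
    simp only [Finset.mem_filter, Finset.mem_univ, true_and] at hg ⊢
    obtain ⟨⟨hgi, hg⟩, hgT⟩ := hg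
    refine ⟨i.2, ?_, ?_, ?_, ?_⟩
    · intro e he
      obtain ⟨v, hv, rfl⟩ := (hmem g e).1 he
      exact ⟨hgT v hv, v.2, (g v).2⟩
    · intro e he h
      obtain ⟨v, hv, rfl⟩ := (hmem g e).1 he
      exact hv (Subtype.ext h)
    · intro v hv hvi
      refine ⟨(g ⟨v, hv⟩).1, (hmem g _).2 ⟨⟨v, hv⟩, fun h => hvi (congrArg Subtype.val h), rfl⟩, ?_⟩
      intro u hu
      obtain ⟨v', hv', he⟩ := (hmem g _).1 hu
      simp only [Prod.mk.injEq] at he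
      obtain ⟨rfl, rfl⟩ := he
      rfl
    · intro v hv
      obtain ⟨n, hn⟩ := hg ⟨v, hv⟩
      induction n generalizing v with
      | zero =>
        have : v = i.1 := congrArg Subtype.val hn
        rw [this]
      | succ n ih =>
        by_cases hvi : (⟨v, hv⟩ : R.1) = i
        · have : v = i.1 := congrArg Subtype.val hvi
          rw [this]
        · exact (ih (g ⟨v, hv⟩).1 (g ⟨v, hv⟩).2 hn).tail ((hmem g _).2 ⟨⟨v, hv⟩, hvi, rfl⟩)
  · intro g hg g' hg' he
    simp only [Finset.mem_filter, Finset.mem_univ, true_and] at hg hg'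
    funext v
    by_cases hv : v = i
    · rw [hv, hg.1.1, hg'.1.1]
    · have h1 := (hmem g _).2 ⟨v, hv, rfl⟩
      rw [he] at h1
      obtain ⟨v', _, he'⟩ := (hmem g' _).1 h1
      simp only [Prod.mk.injEq] at he'
      obtain ⟨h2, h3⟩ := he'
      rw [Subtype.ext h2] at h3
      exact (Subtype.ext h3).symm
  · intro B hB
    simp only [Finset.mem_filter, Finset.mem_univ, true_and] at hB
    obtain ⟨-, hBR, hBi, hBu, hBr⟩ := hB
    have hex : ∀ v : R.1, v ≠ i → ∃ u : R.1, (v.1, u.1) ∈ B := by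
      intro v hv
      obtain ⟨u, hu, -⟩ := hBu v v.2 fun h => hv (Subtype.ext h)
      exact ⟨⟨u, (hBR _ hu).2.2⟩, hu⟩
    choose p hp using hex
    set g : R.1 → R.1 := fun v => if hv : v = i then i else p v hv with hg
    have hgB : ∀ v, v ≠ i → (v.1, (g v).1) ∈ B := fun v hv => by
      simpa only [hg, dif_neg hv] using hp v hv
    have hgu : ∀ c b : V, (c, b) ∈ B → ∀ hc : c ∈ R.1, (g ⟨c, hc⟩).1 = b := by
      intro c b h hc
      have hci : c ≠ i := hBi _ h
      exact (hBu c hc hci).unique (hgB ⟨c, hc⟩ fun h => hci (congrArg Subtype.val h)) h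
    refine ⟨g, ?_, ?_⟩
    · simp only [Finset.mem_filter, Finset.mem_univ, true_and]
      refine ⟨⟨by simp [hg], fun v => ?_⟩, fun v hv => (hBR _ (hgB v hv)).1⟩
      -- Following parents retraces, in reverse, the path in `B` from the root to `c`.
      have key : ∀ c, Relation.ReflTransGen (EdgeFromTo (B : Set (V × V))) i.1 c →
          ∀ hc : c ∈ R.1, ∃ n, g^[n] ⟨c, hc⟩ = i := by
        intro c h
        induction h with
        | refl => exact fun _ => ⟨0, rfl⟩
        | @tail b c _ hbc ih =>
          intro hc
          have hbc' : (c, b) ∈ B := hbc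
          obtain ⟨n, hn⟩ := ih (hBR _ hbc').2.2
          refine ⟨n + 1, ?_⟩
          rw [Function.iterate_succ_apply, ← hn]
          congr 1
          exact Subtype.ext (hgu c b hbc' hc)
      exact key v (hBr v v.2) v.2
    · ext e
      rw [hmem]
      constructor
      · rintro ⟨v, hv, rfl⟩
        exact hgB v hv
      · intro he
        have hc := (hBR e he).2.1
        exact ⟨⟨e.1, hc⟩, fun h => hBi e he (congrArg Subtype.val h), Prod.ext rfl (hgu _ _ he hc)⟩
  · intro g _
    rw [Finset.prod_image]
    intro v _ v' _ h
    exact Subtype.ext (congrArg Prod.fst h)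

theorem weightVector_eq_zero (w : V → V → ℝ) (R : Reach T) {i : V} (hi : i ∉ R.1) :
    weightVector w T R i = 0 := by
  classical
  rw [weightVector, Finset.filter_false_of_mem, Finset.sum_empty]
  exact fun B _ h => hi h.1

theorem weightVector_nonneg {w : V → V → ℝ} (hw : ∀ x y, 0 ≤ w x y) (R : Reach T) (i : V) :
    0 ≤ weightVector w T R i :=
  Finset.sum_nonneg fun _ _ => Finset.prod_nonneg fun _ _ => hw _ _

theorem isRoot_of_weightVector_ne_zero {w : V → V → ℝ} {R : Reach T} {i : V}
    (h : weightVector w T R i ≠ 0) : R.IsRoot i := by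
  classical
  have hi : i ∈ R.1 := by
    by_contra hi
    exact h (weightVector_eq_zero w R hi)
  rw [weightVector_eq_treeSum w R ⟨i, hi⟩] at h
  refine Reach.isRoot_of_subset fun v hv => ?_
  refine Relation.ReflTransGen.lift Subtype.val (fun x y hxy => ?_) _ _
    (treeSum_ne_zero_imp h ⟨v, hv⟩)
  by_contra hT
  exact hxy (if_neg hT)

theorem weightVector_pos {w : V → V → ℝ} (hw : ∀ x y, 0 ≤ w x y)
    (hT : ∀ e ∈ T, 0 < w e.1 e.2) {R : Reach T} {i : V} (hi : R.IsRoot i) :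
    0 < weightVector w T R i := by
  classical
  rw [weightVector_eq_treeSum w R ⟨i, hi.mem⟩]
  refine treeSum_pos (fun x y => ?_) ?_
  · split_ifs
    exacts [hw _ _, le_rfl]
  · have key : ∀ v, Relation.ReflTransGen (EdgeFromTo T) i v → ∀ hv : v ∈ R.1,
        Relation.ReflTransGen (fun u v : R.1 => 0 < if (v.1, u.1) ∈ T then w v u else 0)
          ⟨i, hi.mem⟩ ⟨v, hv⟩ := by
      intro v h
      induction h with
      | refl => exact fun _ => Relation.ReflTransGen.refl
      | @tail b c hb hbc ih =>
        intro hc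
        have hbR : b ∈ R.1 := Reach.mem_of_reachable hi.mem hb
        have hbc' : (c, b) ∈ T := hbc
        refine (ih hbR).tail ?_
        rw [if_pos hbc']
        exact hT _ hbc'
    rintro ⟨v, hv⟩
    exact key v (hi.le hv) hv

end Trees

end Reaches

/-! ### Maximum principle and harmonic functions. -/

namespace WeightedDigraph

variable {V : Type*} (G : WeightedDigraph V) (F : Set (V × V))

theorem restrictWeight_nonneg (x y : V) : 0 ≤ G.restrictWeight F x y := by
  unfold restrictWeight
  split_ifs
  exacts [G.a_nonneg x y, le_rfl]

theorem restrictWeight_of_notMem {x y : V} (h : (x, y) ∉ F) : G.restrictWeight F x y = 0 :=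
  if_neg h

variable {F}

theorem restrictWeight_pos (hF : F ⊆ G.edges) {x y : V} (h : (x, y) ∈ F) :
    0 < G.restrictWeight F x y := by
  unfold restrictWeight
  rw [if_pos h]
  exact hF h

variable [Fintype V]

/-- A function that is subharmonic where it is positive, and nonpositive at some root of each
reach, is nonpositive. -/
theorem nonpos_of_subharmonic (hF : F ⊆ G.edges) {f : V → ℝ}
    (hf : ∀ x, 0 < f x → ∑ y, G.restrictWeight F y x * (f x - f y) ≤ 0)
    (hr : ∀ R : Reach (transposeEdges F), ∃ u, R.IsRoot u ∧ f u ≤ 0) (x : V) : f x ≤ 0 := by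
  by_contra! hx
  have : Nonempty V := ⟨x⟩
  obtain ⟨x₀, hx₀⟩ := Finite.exists_max f
  have hpos : 0 < f x₀ := hx.trans_le (hx₀ x)
  -- At a point where the positive maximum is attained all terms of the sum are nonnegative, so the
  -- value passes to every predecessor in the transposed graph, and finally to a root of a reach
  -- containing `x₀`.
  have key : ∀ y, Relation.ReflTransGen (EdgeFromTo (transposeEdges F)) y x₀ → f y = f x₀ := by
    intro y h
    induction h using Relation.ReflTransGen.head_induction_on with
    | refl => rfl
    | @head y z hyz _ ih =>
      have hyz' : (y, z) ∈ F := hyz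
      have h1 := hf z (ih ▸ hpos)
      have h2 : G.restrictWeight F y z * (f z - f y) ≤
          ∑ y, G.restrictWeight F y z * (f z - f y) :=
        Finset.single_le_sum (f := fun y => G.restrictWeight F y z * (f z - f y))
          (fun y _ => mul_nonneg (G.restrictWeight_nonneg F y z) (by rw [ih]; linarith [hx₀ y]))
          (Finset.mem_univ y)
      have h3 : f z - f y ≤ 0 :=
        nonpos_of_mul_nonpos_right (h2.trans h1) (G.restrictWeight_pos hF hyz')
      have := hx₀ y
      linarith
  obtain ⟨R, hR⟩ := exists_reach_mem (transposeEdges F) x₀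
  obtain ⟨u, hu, hfu⟩ := hr R
  rw [hu] at hR
  rw [key u hR] at hfu
  linarith

/-- The maximum principle for `f` and `-f`. Harmonicity is asked only where `f` is nonzero, so that
functions on a common part may be extended by zero. -/
theorem eq_zero_of_harmonic (hF : F ⊆ G.edges) {f : V → ℝ}
    (hf : ∀ x, f x ≠ 0 → ∑ y, G.restrictWeight F y x * (f x - f y) = 0)
    (hr : ∀ R : Reach (transposeEdges F), ∃ u, R.IsRoot u ∧ f u = 0) (x : V) : f x = 0 := by
  refine le_antisymm (G.nonpos_of_subharmonic hF (fun x hx => (hf x hx.ne').le)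
    (fun R => (hr R).imp fun u h => ⟨h.1, h.2.le⟩) x) ?_
  have h := G.nonpos_of_subharmonic hF (f := fun x => -f x) (fun x hx => ?_)
    (fun R => (hr R).imp fun u h => ⟨h.1, by simp [h.2]⟩) x
  · linarith
  · have h1 := hf x (by rintro h0; simp [h0] at hx)
    rw [← neg_eq_zero, ← Finset.sum_neg_distrib] at h1
    refine le_of_eq (Eq.trans (Finset.sum_congr rfl fun y _ => ?_) h1)
    ring

variable (F)

theorem sum_inLaplacianTranspose_mul (f : V → ℝ) (x : V) :
    ∑ y, G.inLaplacianTranspose F x y * f y =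
      1 / G.m x * ∑ y, G.restrictWeight F y x * (f x - f y) := by
  classical
  simp only [inLaplacianTranspose, Matrix.of_apply, mul_sub, sub_mul, Finset.sum_sub_distrib,
    mul_ite, ite_mul, mul_zero, zero_mul, Finset.sum_ite_eq, Finset.mem_univ, if_true,
    Finset.mul_sum, Finset.sum_mul]
  congr 1 <;> exact Finset.sum_congr rfl fun y _ => by ring

variable {F}

theorem sum_commonBlock_mul (R : Reach (transposeEdges F))
    [Fintype (commonPart (transposeEdges F) R)]
    {f : V → ℝ} (hf : ∀ v, v ∉ commonPart (transposeEdges F) R → f v = 0)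
    (x : commonPart (transposeEdges F) R) :
    (G.commonBlock F R).mulVec (fun y => f y) x = ∑ y, G.inLaplacianTranspose F x y * f y := by
  classical
  have h : ∑ y : commonPart (transposeEdges F) R, G.inLaplacianTranspose F x y * f y =
      ∑ y ∈ Finset.univ.filter (· ∈ commonPart (transposeEdges F) R),
        G.inLaplacianTranspose F x y * f y :=
    (Finset.sum_subtype _ (by simp) fun y => G.inLaplacianTranspose F x y * f y).symm
  refine h.trans (Finset.sum_filter_of_ne fun y _ hy => ?_)
  by_contra hc
  exact hy (by rw [hf y hc, mul_zero])

-- A kernel vector extended by zero is harmonic wherever it is nonzero and vanishes at all roots,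
-- since no root lies in a common part. Hence it is zero, and the inverse in `gammaLeft` is a
-- genuine one rather than the default value.
open Classical in
theorem isUnit_commonBlock (hF : F ⊆ G.edges) (R : Reach (transposeEdges F)) :
    IsUnit (G.commonBlock F R) := by
  rw [← Matrix.mulVec_injective_iff_isUnit]
  refine (injective_iff_map_eq_zero (G.commonBlock F R).mulVecLin).2 fun g hg => ?_
  set f : V → ℝ := fun v => if hv : v ∈ commonPart (transposeEdges F) R then g ⟨v, hv⟩ else 0
  have hfg : (fun y : commonPart (transposeEdges F) R => f y) = g := by
    funext y
    exact dif_pos y.2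
  have hf0 : ∀ v, v ∉ commonPart (transposeEdges F) R → f v = 0 := fun v hv => dif_neg hv
  have h0 : ∀ x, f x = 0 := by
    refine G.eq_zero_of_harmonic hF (fun x hx => ?_) fun S => ⟨S.root, S.isRoot_root, hf0 _ ?_⟩
    · have hxC : x ∈ commonPart (transposeEdges F) R := by
        by_contra hc
        exact hx (hf0 x hc)
      have h1 := G.sum_commonBlock_mul R hf0 ⟨x, hxC⟩
      rw [hfg, sum_inLaplacianTranspose_mul] at h1
      have h2 : (G.commonBlock F R).mulVec g ⟨x, hxC⟩ = 0 := congrFun hg ⟨x, hxC⟩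
      rw [h2] at h1
      have h3 : 1 / G.m x ≠ 0 := one_div_ne_zero (G.m_pos x).ne'
      exact (mul_eq_zero.1 h1.symm).resolve_left h3
    · intro hc
      have := S.isRoot_root.eq_of_mem hc.1
      exact disjoint_exclusivePart_commonPart _ S.isRoot_root.mem_exclusivePart (this ▸ hc)
  rw [← hfg]
  funext y
  exact h0 y

theorem gammaLeft_of_mem_exclusivePart {R : Reach (transposeEdges F)} {v : V}
    (h : v ∈ exclusivePart (transposeEdges F) R) : G.gammaLeft F R v = 1 := if_pos h

theorem gammaLeft_of_notMem {R : Reach (transposeEdges F)} {v : V} (h : v ∉ R.1) :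
    G.gammaLeft F R v = 0 := by
  unfold gammaLeft
  rw [if_neg fun h' => h h'.1, dif_neg fun h' => h h'.1]

theorem sum_restrictWeight_mul_gammaLeft_of_mem_commonPart (hF : F ⊆ G.edges)
    (R : Reach (transposeEdges F)) {x : V} (hx : x ∈ commonPart (transposeEdges F) R) :
    ∑ y, G.restrictWeight F y x * (G.gammaLeft F R x - G.gammaLeft F R y) = 0 := by
  classical
  have h3 : 1 / G.m x ≠ 0 := one_div_ne_zero (G.m_pos x).ne'
  refine (mul_eq_zero.1 ?_).resolve_left h3
  rw [← sum_inLaplacianTranspose_mul]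
  set b : commonPart (transposeEdges F) R → ℝ := fun x =>
    ∑ y with y ∈ exclusivePart (transposeEdges F) R, G.inLaplacianTranspose F x.1 y with hb
  set f : V → ℝ := fun v => if hv : v ∈ commonPart (transposeEdges F) R then
    -((G.commonBlock F R)⁻¹.mulVec b ⟨v, hv⟩) else 0
  have hf0 : ∀ v, v ∉ commonPart (transposeEdges F) R → f v = 0 := fun v hv => dif_neg hv
  have hfC : (fun y : commonPart (transposeEdges F) R => f y) = -(G.commonBlock F R)⁻¹.mulVec b := by
    funext y
    exact dif_pos y.2
  have h1 := G.sum_commonBlock_mul R hf0 ⟨x, hx⟩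
  have hu : IsUnit (G.commonBlock F R).det :=
    (Matrix.isUnit_iff_isUnit_det _).1 (G.isUnit_commonBlock hF R)
  rw [hfC, Matrix.mulVec_neg, Matrix.mulVec_mulVec, Matrix.mul_nonsing_inv _ hu,
    Matrix.one_mulVec] at h1
  have hsplit : ∀ y, G.inLaplacianTranspose F x y * G.gammaLeft F R y =
      (if y ∈ exclusivePart (transposeEdges F) R then G.inLaplacianTranspose F x y else 0) +
        G.inLaplacianTranspose F x y * f y := by
    intro y
    by_cases hH : y ∈ exclusivePart (transposeEdges F) R
    · rw [if_pos hH, G.gammaLeft_of_mem_exclusivePart hH,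
        hf0 y (disjoint_exclusivePart_commonPart R hH)]
      ring
    · rw [if_neg hH, zero_add]
      congr 1
      unfold gammaLeft
      rw [if_neg hH]
  rw [Finset.sum_congr rfl fun y _ => hsplit y, Finset.sum_add_distrib, ← h1, ← Finset.sum_filter,
    Pi.neg_apply, hb, add_neg_cancel]

/-- The vectors `gammaLeft` are harmonic. -/
theorem sum_restrictWeight_mul_gammaLeft (hF : F ⊆ G.edges)
    (R : Reach (transposeEdges F)) (x : V) :
    ∑ y, G.restrictWeight F y x * (G.gammaLeft F R x - G.gammaLeft F R y) = 0 := by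
  by_cases hx : x ∈ R.1
  -- On the exclusive part, and outside `R`, `gammaLeft` is locally constant: both sets are closed
  -- under predecessors in the transposed graph. Only the common part uses the matrix inverse.
  · rcases mem_exclusivePart_or_commonPart R hx with hH | hC
    · refine Finset.sum_eq_zero fun y _ => ?_
      by_cases hy : (y, x) ∈ F
      · rw [G.gammaLeft_of_mem_exclusivePart hH,
          G.gammaLeft_of_mem_exclusivePart (exclusivePart_of_edge (T := transposeEdges F) hy hH),
          sub_self, mul_zero]
      · rw [G.restrictWeight_of_notMem F hy, zero_mul]
    · exact G.sum_restrictWeight_mul_gammaLeft_of_mem_commonPart hF R hC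
  · refine Finset.sum_eq_zero fun y _ => ?_
    by_cases hy : (y, x) ∈ F
    · have hyR : y ∉ R.1 := fun h => hx (Reach.mem_of_reachable h (Relation.ReflTransGen.single hy))
      rw [G.gammaLeft_of_notMem hx, G.gammaLeft_of_notMem hyR, sub_self, mul_zero]
    · rw [G.restrictWeight_of_notMem F hy, zero_mul]

theorem gammaLeft_of_isRoot {R : Reach (transposeEdges F)} {u : V} (h : R.IsRoot u) :
    G.gammaLeft F R u = 1 := G.gammaLeft_of_mem_exclusivePart h.mem_exclusivePart

theorem gammaLeft_of_isRoot_of_ne {R S : Reach (transposeEdges F)} {u : V} (h : S.IsRoot u)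
    (hne : R ≠ S) : G.gammaLeft F R u = 0 :=
  G.gammaLeft_of_notMem fun hu => hne (h.eq_of_mem hu)

/-- The maximum principle for `-gammaLeft`, whose values at roots are `0` and `-1`. -/
theorem gammaLeft_nonneg (hF : F ⊆ G.edges) (R : Reach (transposeEdges F)) (x : V) :
    0 ≤ G.gammaLeft F R x := by
  have h := G.nonpos_of_subharmonic hF (f := fun x => -G.gammaLeft F R x) (fun x _ => ?_)
    (fun S => ⟨S.root, S.isRoot_root, ?_⟩) x
  · linarith
  · have h1 := G.sum_restrictWeight_mul_gammaLeft hF R x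
    rw [← neg_eq_zero, ← Finset.sum_neg_distrib] at h1
    refine le_of_eq (Eq.trans (Finset.sum_congr rfl fun y _ => ?_) h1)
    ring
  · by_cases hS : R = S
    · subst hS
      rw [G.gammaLeft_of_isRoot R.isRoot_root]
      norm_num
    · rw [G.gammaLeft_of_isRoot_of_ne S.isRoot_root hS, neg_zero]

/-- A harmonic function is the combination of the `gammaLeft` given by its values at roots. -/
theorem eq_sum_gammaLeft_of_harmonic (hF : F ⊆ G.edges) {f : V → ℝ}
    (hf : ∀ x, ∑ y, G.restrictWeight F y x * (f x - f y) = 0) (x : V) :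
    f x = ∑ R : Reach (transposeEdges F), f R.root * G.gammaLeft F R x := by
  rw [← sub_eq_zero]
  refine G.eq_zero_of_harmonic hF
    (f := fun x => f x - ∑ R : Reach (transposeEdges F), f R.root * G.gammaLeft F R x)
    (fun x _ => ?_) (fun S => ⟨S.root, S.isRoot_root, ?_⟩) x
  · have h1 : ∑ R : Reach (transposeEdges F), f R.root *
        ∑ y, G.restrictWeight F y x * (G.gammaLeft F R x - G.gammaLeft F R y) = 0 :=
      Finset.sum_eq_zero fun R _ => by rw [G.sum_restrictWeight_mul_gammaLeft hF, mul_zero]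
    simp only [Finset.mul_sum] at h1
    rw [Finset.sum_comm] at h1
    rw [← sub_eq_zero.2 ((hf x).trans h1.symm), ← Finset.sum_sub_distrib]
    refine Finset.sum_congr rfl fun y _ => ?_
    have : ∑ R : Reach (transposeEdges F), f R.root *
        (G.restrictWeight F y x * (G.gammaLeft F R x - G.gammaLeft F R y)) =
        G.restrictWeight F y x * (∑ R : Reach (transposeEdges F), f R.root * G.gammaLeft F R x -
          ∑ R : Reach (transposeEdges F), f R.root * G.gammaLeft F R y) := by
      rw [← Finset.sum_sub_distrib, Finset.mul_sum]
      exact Finset.sum_congr rfl fun R _ => by ring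
    rw [this]
    ring
  · rw [Finset.sum_eq_single S, G.gammaLeft_of_isRoot S.isRoot_root, mul_one, sub_self]
    · intro R _ hR
      rw [G.gammaLeft_of_isRoot_of_ne S.isRoot_root hR, mul_zero]
    · exact fun h => absurd (Finset.mem_univ S) h

/-- The constant `1` is harmonic and equals `1` at every root. -/
theorem sum_gammaLeft (hF : F ⊆ G.edges) (x : V) :
    ∑ R : Reach (transposeEdges F), G.gammaLeft F R x = 1 := by
  have h := G.eq_sum_gammaLeft_of_harmonic hF (f := fun _ => 1) (fun x => by simp) x
  simpa using h.symm

/-! ### The vectors `gammaRight` -/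

variable (F)

/-- The weight vector of a reach in the definition of `gammaRight`. -/
noncomputable def omega (R : Reach (transposeEdges F)) (j : V) : ℝ :=
  weightVector (fun x y => G.a y x) (transposeEdges F) R j

variable {F}

theorem omega_nonneg (R : Reach (transposeEdges F)) (x : V) : 0 ≤ G.omega F R x :=
  weightVector_nonneg (fun _ _ => G.a_nonneg _ _) R x

theorem isRoot_of_omega_ne_zero {R : Reach (transposeEdges F)} {x : V} (h : G.omega F R x ≠ 0) :
    R.IsRoot x := isRoot_of_weightVector_ne_zero h

theorem omega_pos (hF : F ⊆ G.edges) {R : Reach (transposeEdges F)} {x : V} (h : R.IsRoot x) :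
    0 < G.omega F R x :=
  weightVector_pos (w := fun x y => G.a y x) (fun _ _ => G.a_nonneg _ _) (fun e he => hF (a := (e.2, e.1)) he) h

theorem sum_mass_omega_pos (hF : F ⊆ G.edges) (R : Reach (transposeEdges F)) :
    0 < ∑ k, G.m k * G.omega F R k :=
  Finset.sum_pos' (fun k _ => mul_nonneg (G.m_pos k).le (G.omega_nonneg R k))
    ⟨R.root, Finset.mem_univ _, mul_pos (G.m_pos _) (G.omega_pos hF R.isRoot_root)⟩

/-- The weight vectors are stationary. -/
theorem sum_restrictWeight_mul_omega (R : Reach (transposeEdges F)) (x : V) :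
    (∑ j, G.restrictWeight F j x) * G.omega F R x = ∑ y, G.restrictWeight F x y * G.omega F R y := by
  classical
  -- Weight vectors live on roots, and a predecessor of a root is again a root. So no edge between
  -- `R` and its complement contributes, and the tree theorem on `R` gives stationarity on all of
  -- `V`.
  have hroot : ∀ y z, (y, z) ∈ F → G.omega F R z ≠ 0 → y ∈ R.1 := fun y z hyz hz =>
    ((G.isRoot_of_omega_ne_zero hz).of_reachable (v := y) (Relation.ReflTransGen.single hyz)).mem
  by_cases hx : x ∈ R.1
  · have h := sum_mul_treeSum
      (fun x y : R.1 => if (x.1, y.1) ∈ transposeEdges F then G.a y x else 0) ⟨x, hx⟩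
    have ho : ∀ i : R.1, treeSum
        (fun x y : R.1 => if (x.1, y.1) ∈ transposeEdges F then G.a y x else 0) i =
        G.omega F R i := fun i => (weightVector_eq_treeSum (fun x y => G.a y x) R i).symm
    simp only [ho] at h
    have hsub : ∀ p : V → ℝ, (∀ y, p y ≠ 0 → y ∈ R.1) → ∑ y : R.1, p y = ∑ y, p y := by
      intro p hp
      rw [← Finset.sum_filter_of_ne (p := (· ∈ R.1)) fun y _ hy => hp y hy]
      exact (Finset.sum_subtype _ (by simp) p).symm
    rw [Finset.sum_mul] at h ⊢
    rw [← hsub (fun y => G.restrictWeight F x y * G.omega F R y), ← hsub]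
    · exact h
    · intro y hy
      refine hroot y x ?_ (right_ne_zero_of_mul hy)
      by_contra hn
      exact hy (by rw [G.restrictWeight_of_notMem F hn, zero_mul])
    · intro y hy
      exact (G.isRoot_of_omega_ne_zero (right_ne_zero_of_mul hy)).mem
  · have hx0 : G.omega F R x = 0 := weightVector_eq_zero _ R hx
    rw [hx0, mul_zero]
    refine (Finset.sum_eq_zero fun y _ => ?_).symm
    by_contra hy
    refine hx (hroot x y ?_ (right_ne_zero_of_mul hy))
    by_contra hn
    exact hy (by rw [G.restrictWeight_of_notMem F hn, zero_mul])

theorem gammaRight_nonneg (hF : F ⊆ G.edges) (R : Reach (transposeEdges F)) (x : V) :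
    0 ≤ G.gammaRight F R x :=
  div_nonneg (G.omega_nonneg R x) (G.sum_mass_omega_pos hF R).le

theorem isRoot_of_gammaRight_ne_zero {R : Reach (transposeEdges F)} {x : V}
    (h : G.gammaRight F R x ≠ 0) : R.IsRoot x :=
  G.isRoot_of_omega_ne_zero fun h0 => h (by
    change G.omega F R x / _ = 0
    rw [h0, zero_div])

theorem sum_mass_mul_gammaRight (hF : F ⊆ G.edges) (R : Reach (transposeEdges F)) :
    ∑ x, G.m x * G.gammaRight F R x = 1 := by
  have h : ∀ x, G.m x * G.gammaRight F R x =
      G.m x * G.omega F R x / ∑ k, G.m k * G.omega F R k := fun x => mul_div_assoc' _ _ _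
  rw [Finset.sum_congr rfl fun x _ => h x, ← Finset.sum_div,
    div_self (G.sum_mass_omega_pos hF R).ne']

theorem sum_restrictWeight_mul_gammaRight (R : Reach (transposeEdges F)) (x : V) :
    (∑ j, G.restrictWeight F j x) * G.gammaRight F R x =
      ∑ y, G.restrictWeight F x y * G.gammaRight F R y := by
  have h : ∀ y, G.gammaRight F R y = G.omega F R y / ∑ k, G.m k * G.omega F R k := fun _ => rfl
  simp only [h, mul_div_assoc', ← Finset.sum_div]
  rw [G.sum_restrictWeight_mul_omega R x]

/-- Biorthogonality holds already pointwise: `gammaRight` is supported on the roots of its reach,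
where the matching `gammaLeft` is `1` and every other one is `0`. -/
theorem gammaLeft_mul_gammaRight_self (R : Reach (transposeEdges F)) (x : V) :
    G.gammaLeft F R x * G.gammaRight F R x = G.gammaRight F R x := by
  by_cases h : G.gammaRight F R x = 0
  · rw [h, mul_zero]
  · rw [G.gammaLeft_of_isRoot (G.isRoot_of_gammaRight_ne_zero h), one_mul]

theorem gammaLeft_mul_gammaRight_of_ne {R S : Reach (transposeEdges F)} (hne : R ≠ S) (x : V) :
    G.gammaLeft F R x * G.gammaRight F S x = 0 := by
  by_cases h : G.gammaRight F S x = 0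
  · rw [h, mul_zero]
  · rw [G.gammaLeft_of_isRoot_of_ne (G.isRoot_of_gammaRight_ne_zero h) hne, zero_mul]

end WeightedDigraph

/-! ### Laplacians on `ℓ²(G)`. -/

namespace WeightedDigraph

variable {V : Type*} (G : WeightedDigraph V)

theorem mass_ne_zero (x : V) : (G.m x : ℂ) ≠ 0 := Complex.ofReal_ne_zero.2 (G.m_pos x).ne'

variable [Fintype V]

theorem inner_def (f g : G.Ell2) :
    inner ℂ f g = ∑ x, (starRingEnd ℂ) (f x) * g x * (G.m x : ℂ) := rfl

theorem outLaplacianWith_apply (w : V → V → ℝ) (f : G.Ell2) (x : V) :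
    G.outLaplacianWith w f x =
      (1 / (G.m x : ℂ)) * ((∑ j, (w j x : ℂ)) * f x - ∑ y, (w x y : ℂ) * f y) := rfl

theorem outLaplacianWith_add_smul (w₀ w₁ : V → V → ℝ) (β : ℝ) :
    G.outLaplacianWith w₀ + (β : ℂ) • G.outLaplacianWith w₁ =
      G.outLaplacianWith fun x y => w₀ x y + β * w₁ x y := by
  refine ContinuousLinearMap.ext fun f => funext fun x => ?_
  change G.outLaplacianWith w₀ f x + β * G.outLaplacianWith w₁ f x = _
  simp only [outLaplacianWith_apply, Complex.ofReal_add, Complex.ofReal_mul, add_mul,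
    Finset.sum_add_distrib, mul_assoc, ← Finset.mul_sum]
  ring

/-- The node masses cancel, and the adjoint appears as a difference operator; vectors orthogonal to
the range are therefore the harmonic functions. -/
theorem inner_outLaplacianWith (w : V → V → ℝ) (g f : G.Ell2) :
    inner ℂ g (G.outLaplacianWith w f) =
      ∑ y, (∑ x, (w x y : ℂ) * (starRingEnd ℂ) (g y - g x)) * f y := by
  have h1 : ∀ x, (starRingEnd ℂ) (g x) * G.outLaplacianWith w f x * (G.m x : ℂ) =
      (∑ j, (w j x : ℂ) * (starRingEnd ℂ) (g x) * f x) -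
        ∑ y, (w x y : ℂ) * (starRingEnd ℂ) (g x) * f y := by
    intro x
    rw [outLaplacianWith_apply, ← Finset.sum_mul, ← Finset.sum_mul]
    have : ∑ y, (w x y : ℂ) * (starRingEnd ℂ) (g x) * f y =
        (starRingEnd ℂ) (g x) * ∑ y, (w x y : ℂ) * f y := by
      rw [Finset.mul_sum]
      exact Finset.sum_congr rfl fun y _ => by ring
    rw [this]
    have hm := G.mass_ne_zero x
    field_simp
  rw [inner_def, Finset.sum_congr rfl fun x _ => h1 x, Finset.sum_sub_distrib]
  rw [Finset.sum_comm (f := fun x y => (w x y : ℂ) * (starRingEnd ℂ) (g x) * f y),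
    ← Finset.sum_sub_distrib]
  refine Finset.sum_congr rfl fun y _ => ?_
  rw [← Finset.sum_sub_distrib, Finset.sum_mul]
  exact Finset.sum_congr rfl fun x _ => by rw [map_sub]; ring

/-! ### Uniform boundedness of the semigroups -/

/-- The weighted `ℓ¹` norm. -/
noncomputable def massNorm (f : G.Ell2) : ℝ := ∑ x, G.m x * ‖f x‖

/-- For `c` above all out-degrees per mass, `1 - c⁻¹ L` has nonnegative entries, and what leaves a
node equals what arrives elsewhere, so the weighted `ℓ¹` norm cannot grow. -/
theorem massNorm_sub_outLaplacianWith_le {w : V → V → ℝ} (hw : ∀ x y, 0 ≤ w x y) {c : ℝ}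
    (hc : 0 < c) (hwc : ∀ x, ∑ j, w j x ≤ c * G.m x) (f : G.Ell2) :
    G.massNorm (((1 : G.Ell2 →L[ℂ] G.Ell2) - ((c⁻¹ : ℝ) : ℂ) • G.outLaplacianWith w) f) ≤
      G.massNorm f := by
  have h1 : ∀ x, G.m x * ‖((1 : G.Ell2 →L[ℂ] G.Ell2) -
      ((c⁻¹ : ℝ) : ℂ) • G.outLaplacianWith w) f x‖ ≤
      G.m x * ‖f x‖ - c⁻¹ * (∑ j, w j x) * ‖f x‖ + c⁻¹ * ∑ y, w x y * ‖f y‖ := by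
    intro x
    have hm := G.m_pos x
    have e : ((1 : G.Ell2 →L[ℂ] G.Ell2) - ((c⁻¹ : ℝ) : ℂ) • G.outLaplacianWith w) f x =
        ((1 - c⁻¹ * (∑ j, w j x) / G.m x : ℝ) : ℂ) * f x +
          ((c⁻¹ / G.m x : ℝ) : ℂ) * ∑ y, (w x y : ℂ) * f y := by
      change f x - ((c⁻¹ : ℝ) : ℂ) * G.outLaplacianWith w f x = _
      rw [outLaplacianWith_apply]
      push_cast
      ring
    have h2 : 0 ≤ 1 - c⁻¹ * (∑ j, w j x) / G.m x := by
      rw [sub_nonneg, div_le_one hm, inv_mul_le_iff₀ hc]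
      exact hwc x
    have h3 : ‖∑ y, (w x y : ℂ) * f y‖ ≤ ∑ y, w x y * ‖f y‖ := by
      refine (norm_sum_le _ _).trans (le_of_eq (Finset.sum_congr rfl fun y _ => ?_))
      rw [norm_mul, Complex.norm_real, Real.norm_of_nonneg (hw x y)]
    calc G.m x * ‖_‖ ≤ G.m x * ((1 - c⁻¹ * (∑ j, w j x) / G.m x) * ‖f x‖ +
          c⁻¹ / G.m x * ∑ y, w x y * ‖f y‖) := by
          rw [e]
          refine mul_le_mul_of_nonneg_left ((norm_add_le _ _).trans (add_le_add ?_ ?_)) hm.le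
          · rw [norm_mul, Complex.norm_real, Real.norm_of_nonneg h2]
          · rw [norm_mul, Complex.norm_real, Real.norm_of_nonneg (by positivity)]
            gcongr
      _ = _ := by field_simp
  refine (Finset.sum_le_sum fun x _ => h1 x).trans (le_of_eq ?_)
  rw [Finset.sum_add_distrib, Finset.sum_sub_distrib, ← Finset.mul_sum, Finset.sum_comm]
  simp only [← Finset.sum_mul, mul_assoc, ← Finset.mul_sum]
  rw [sub_add_cancel]
  rfl

/-- Equivalence of norms in finite dimension. The constant depends on `G` alone, so one bound serves
all powers of all the operators `K`, whatever `β`. -/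
theorem exists_norm_le_of_massNorm_le : ∃ C : ℝ, ∀ T : G.Ell2 →L[ℂ] G.Ell2,
    (∀ f, G.massNorm (T f) ≤ G.massNorm f) → ‖T‖ ≤ C := by
  classical
  let ev : V → G.Ell2 →L[ℂ] ℂ := fun x =>
    LinearMap.toContinuousLinearMap (LinearMap.proj (R := ℂ) (φ := fun _ : V => ℂ) x)
  let e : V → G.Ell2 := fun x => Pi.single x (1 : ℂ)
  have h1 : ∀ f : G.Ell2, G.massNorm f ≤ (∑ x, G.m x * ‖ev x‖) * ‖f‖ := by
    intro f
    rw [massNorm, Finset.sum_mul]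
    refine Finset.sum_le_sum fun x _ => ?_
    rw [mul_assoc]
    exact mul_le_mul_of_nonneg_left ((ev x).le_opNorm f) (G.m_pos x).le
  have h2 : ∀ f : G.Ell2, ‖f‖ ≤ (∑ x, ‖e x‖ / G.m x) * G.massNorm f := by
    intro f
    have hf : f = ∑ x, f x • e x := by
      refine Eq.trans ?_ (Finset.sum_congr rfl fun x _ => rfl)
      exact pi_eq_sum_univ' f
    have h3 : ‖f‖ ≤ ∑ x, ‖e x‖ / G.m x * (G.m x * ‖f x‖) := by
      conv_lhs => rw [hf]
      refine (norm_sum_le _ _).trans (Finset.sum_le_sum fun x _ => ?_)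
      rw [norm_smul]
      have := G.m_pos x
      field_simp
      rfl
    refine h3.trans ?_
    rw [Finset.sum_mul]
    refine Finset.sum_le_sum fun x _ => ?_
    refine mul_le_mul_of_nonneg_left ?_ (div_nonneg (norm_nonneg _) (G.m_pos x).le)
    exact Finset.single_le_sum (f := fun x => G.m x * ‖f x‖)
      (fun y _ => mul_nonneg (G.m_pos y).le (norm_nonneg _)) (Finset.mem_univ x)
  have h3 : 0 ≤ ∑ x, ‖e x‖ / G.m x :=
    Finset.sum_nonneg fun x _ => div_nonneg (norm_nonneg _) (G.m_pos x).le
  refine ⟨(∑ x, ‖e x‖ / G.m x) * ∑ x, G.m x * ‖ev x‖, fun T hT => ?_⟩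
  refine T.opNorm_le_bound (mul_nonneg h3 (Finset.sum_nonneg fun x _ =>
    mul_nonneg (G.m_pos x).le (ev x).opNorm_nonneg)) fun f => ?_
  calc ‖T f‖ ≤ (∑ x, ‖e x‖ / G.m x) * G.massNorm (T f) := h2 _
    _ ≤ (∑ x, ‖e x‖ / G.m x) * ((∑ x, G.m x * ‖ev x‖) * ‖f‖) := by
      gcongr
      exact (hT f).trans (h1 f)
    _ = _ := by ring

theorem exists_powerBounded (F : Set (V × V)) : ∃ C c : ℝ, 0 < c ∧ ∀ β : ℝ, 0 ≤ β →
    ∃ K : G.Ell2 →L[ℂ] G.Ell2, (∀ n, ‖K ^ n‖ ≤ C) ∧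
      G.outLaplacianOn (G.edges \ F) + (β : ℂ) • G.outLaplacianOn F =
        (((1 + β) * c : ℝ) : ℂ) • (1 - K) := by
  obtain ⟨C, hC⟩ := G.exists_norm_le_of_massNorm_le
  have hm : ∀ x, 0 ≤ (∑ j, G.a j x) / G.m x := fun x =>
    div_nonneg (Finset.sum_nonneg fun j _ => G.a_nonneg j x) (G.m_pos x).le
  -- The sum dominates every out-degree per mass; the summand `1` keeps `c` positive even without
  -- edges.
  set c : ℝ := 1 + ∑ x, (∑ j, G.a j x) / G.m x with hc
  have hc0 : 0 < c := by
    have : 0 ≤ ∑ x, (∑ j, G.a j x) / G.m x := Finset.sum_nonneg fun x _ => hm x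
    linarith
  refine ⟨C, c, hc0, fun β hβ => ?_⟩
  set w : V → V → ℝ := fun x y =>
    G.restrictWeight (G.edges \ F) x y + β * G.restrictWeight F x y with hw
  have hle : ∀ S x y, G.restrictWeight S x y ≤ G.a x y := by
    intro S x y
    unfold restrictWeight
    split_ifs
    exacts [le_rfl, G.a_nonneg x y]
  have hw0 : ∀ x y, 0 ≤ w x y := fun x y =>
    add_nonneg (G.restrictWeight_nonneg _ x y) (mul_nonneg hβ (G.restrictWeight_nonneg _ x y))
  have hpos : 0 < (1 + β) * c := by positivity
  have hwc : ∀ x, ∑ j, w j x ≤ (1 + β) * c * G.m x := by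
    intro x
    have h1 : ∑ j, w j x ≤ (1 + β) * ∑ j, G.a j x := by
      rw [Finset.mul_sum]
      refine Finset.sum_le_sum fun j _ => ?_
      have h2 := hle (G.edges \ F) j x
      have h3 := mul_le_mul_of_nonneg_left (hle F j x) hβ
      simp only [hw]
      linarith
    have h4 : (∑ j, G.a j x) / G.m x ≤ c := by
      have := Finset.single_le_sum (f := fun x => (∑ j, G.a j x) / G.m x) (fun y _ => hm y)
        (Finset.mem_univ x)
      linarith
    rw [div_le_iff₀ (G.m_pos x)] at h4
    calc _ ≤ _ := h1
      _ ≤ (1 + β) * (c * G.m x) := by gcongr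
      _ = _ := by ring
  refine ⟨1 - ((((1 + β) * c)⁻¹ : ℝ) : ℂ) • G.outLaplacianWith w, fun n => hC _ ?_, ?_⟩
  · induction n with
    | zero => exact fun f => le_rfl
    | succ n ih =>
      intro f
      rw [pow_succ']
      exact (G.massNorm_sub_outLaplacianWith_le hw0 hpos hwc _).trans (ih f)
  · rw [sub_sub_cancel, smul_smul, ← Complex.ofReal_mul, mul_inv_cancel₀ hpos.ne',
      Complex.ofReal_one, one_smul]
    exact G.outLaplacianWith_add_smul _ _ β

/-! ### The projection onto the kernel -/

variable (F : Set (V × V))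

/-- The vector `gammaLeft` in `ℓ²(G)`. -/
noncomputable def leftVector (R : Reach (transposeEdges F)) : G.Ell2 :=
  fun v => (G.gammaLeft F R v : ℂ)

/-- The vector `gammaRight` in `ℓ²(G)`. -/
noncomputable def rightVector (R : Reach (transposeEdges F)) : G.Ell2 :=
  fun v => (G.gammaRight F R v : ℂ)

/-- The oblique projection `∑ R, ⟨leftVector R, ·⟩ rightVector R`. -/
noncomputable def kernelProjection : G.Ell2 →L[ℂ] G.Ell2 :=
  ∑ R : Reach (transposeEdges F), (innerSL ℂ (G.leftVector F R)).smulRight (G.rightVector F R)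

theorem kernelProjection_apply (f : G.Ell2) :
    G.kernelProjection F f =
      ∑ R : Reach (transposeEdges F), inner ℂ (G.leftVector F R) f • G.rightVector F R := by
  simp [kernelProjection]

variable {F}

theorem inner_leftVector_rightVector_self (hF : F ⊆ G.edges) (R : Reach (transposeEdges F)) :
    inner ℂ (G.leftVector F R) (G.rightVector F R) = 1 := by
  rw [inner_def]
  have h : ∀ x, (starRingEnd ℂ) (G.leftVector F R x) * G.rightVector F R x * (G.m x : ℂ) =
      ((G.m x * G.gammaRight F R x : ℝ) : ℂ) := by
    intro x
    change (starRingEnd ℂ) (G.gammaLeft F R x : ℂ) * (G.gammaRight F R x : ℂ) * _ = _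
    rw [Complex.conj_ofReal, ← Complex.ofReal_mul, gammaLeft_mul_gammaRight_self]
    push_cast
    ring
  rw [Finset.sum_congr rfl fun x _ => h x, ← Complex.ofReal_sum, G.sum_mass_mul_gammaRight hF,
    Complex.ofReal_one]

theorem inner_leftVector_rightVector_of_ne {R S : Reach (transposeEdges F)} (hne : R ≠ S) :
    inner ℂ (G.leftVector F R) (G.rightVector F S) = 0 := by
  rw [inner_def]
  refine Finset.sum_eq_zero fun x _ => ?_
  change (starRingEnd ℂ) (G.gammaLeft F R x : ℂ) * (G.gammaRight F S x : ℂ) * _ = _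
  rw [Complex.conj_ofReal, ← Complex.ofReal_mul, G.gammaLeft_mul_gammaRight_of_ne hne]
  simp

theorem inner_leftVector_kernelProjection (hF : F ⊆ G.edges) (R : Reach (transposeEdges F))
    (f : G.Ell2) :
    inner ℂ (G.leftVector F R) (G.kernelProjection F f) = inner ℂ (G.leftVector F R) f := by
  rw [kernelProjection_apply, inner_sum, Finset.sum_eq_single R]
  · rw [inner_smul_right, G.inner_leftVector_rightVector_self hF, mul_one]
  · intro S _ hS
    rw [inner_smul_right, G.inner_leftVector_rightVector_of_ne hS.symm, mul_zero]
  · exact fun h => absurd (Finset.mem_univ R) h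

theorem outLaplacianOn_rightVector (R : Reach (transposeEdges F)) :
    G.outLaplacianOn F (G.rightVector F R) = 0 := by
  refine funext fun x => ?_
  have h := G.sum_restrictWeight_mul_gammaRight R x
  have h' := congrArg (fun r : ℝ => (r : ℂ)) h
  simp only [Complex.ofReal_sum, Complex.ofReal_mul] at h'
  change G.outLaplacianWith (G.restrictWeight F) (G.rightVector F R) x = 0
  rw [outLaplacianWith_apply]
  change _ * (_ * (G.gammaRight F R x : ℂ) - ∑ y, _ * (G.gammaRight F R y : ℂ)) = 0
  rw [h', sub_self, mul_zero]

theorem inner_leftVector_outLaplacianOn (hF : F ⊆ G.edges) (R : Reach (transposeEdges F))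
    (f : G.Ell2) : inner ℂ (G.leftVector F R) (G.outLaplacianOn F f) = 0 := by
  rw [outLaplacianOn, inner_outLaplacianWith]
  refine Finset.sum_eq_zero fun y _ => ?_
  have h := congrArg (fun r : ℝ => (r : ℂ)) (G.sum_restrictWeight_mul_gammaLeft hF R y)
  simp only [Complex.ofReal_sum, Complex.ofReal_mul, Complex.ofReal_sub, Complex.ofReal_zero] at h
  have e : ∀ x, (starRingEnd ℂ) (G.leftVector F R y - G.leftVector F R x) =
      (G.gammaLeft F R y : ℂ) - (G.gammaLeft F R x : ℂ) := by
    intro x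
    change (starRingEnd ℂ) ((G.gammaLeft F R y : ℂ) - (G.gammaLeft F R x : ℂ)) = _
    rw [map_sub, Complex.conj_ofReal, Complex.conj_ofReal]
  simp only [e]
  rw [h, zero_mul]

/-- Testing against point masses shows that `g` is harmonic; its real and imaginary parts are then
fixed by their values at roots. -/
theorem eq_sum_smul_leftVector (hF : F ⊆ G.edges) {g : G.Ell2}
    (hg : ∀ f, inner ℂ g (G.outLaplacianOn F f) = 0) :
    g = ∑ R : Reach (transposeEdges F), g R.root • G.leftVector F R := by
  classical
  have h : ∀ y, ∑ x, (G.restrictWeight F x y : ℂ) * (g y - g x) = 0 := by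
    intro y
    obtain ⟨e, he, he'⟩ : ∃ e : G.Ell2, e y = 1 ∧ ∀ b, b ≠ y → e b = 0 :=
      ⟨Pi.single y (1 : ℂ), Pi.single_eq_same (M := fun _ : V => ℂ) y 1,
        fun b hb => Pi.single_eq_of_ne (M := fun _ : V => ℂ) hb 1⟩
    have h1 := hg e
    rw [outLaplacianOn, inner_outLaplacianWith, Finset.sum_eq_single y] at h1
    · rw [he, mul_one] at h1
      have h3 := congrArg (starRingEnd ℂ) h1
      simpa using h3
    · intro b _ hb
      rw [he' b hb, mul_zero]
    · exact fun h => absurd (Finset.mem_univ y) h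
  have hre := G.eq_sum_gammaLeft_of_harmonic hF (f := fun x => (g x).re) fun y => by
    have := congrArg Complex.re (h y)
    simpa using this
  have him := G.eq_sum_gammaLeft_of_harmonic hF (f := fun x => (g x).im) fun y => by
    have := congrArg Complex.im (h y)
    simpa using this
  refine funext fun x => ?_
  have e : (∑ R : Reach (transposeEdges F), g R.root • G.leftVector F R) x =
      ∑ R : Reach (transposeEdges F), g R.root * (G.gammaLeft F R x : ℂ) :=
    Finset.sum_apply (M := fun _ : V => ℂ) x _ _
  rw [e]
  refine Complex.ext ?_ ?_
  · rw [hre x]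
    simp
  · rw [him x]
    simp

/-- Fredholm alternative: the orthogonal complement of the range is spanned by the left vectors. -/
theorem mem_range_outLaplacianOn (hF : F ⊆ G.edges) {f : G.Ell2}
    (hf : ∀ R, inner ℂ (G.leftVector F R) f = 0) :
    f ∈ LinearMap.range (G.outLaplacianOn F : G.Ell2 →ₗ[ℂ] G.Ell2) := by
  rw [← Submodule.orthogonal_orthogonal (LinearMap.range _), Submodule.mem_orthogonal]
  intro g hg
  rw [Submodule.mem_orthogonal'] at hg
  rw [G.eq_sum_smul_leftVector hF (g := g) fun f' => hg _ ⟨f', rfl⟩, sum_inner]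
  exact Finset.sum_eq_zero fun R _ => by rw [inner_smul_left, hf, mul_zero]

theorem kernelProjection_mul_self (hF : F ⊆ G.edges) :
    G.kernelProjection F * G.kernelProjection F = G.kernelProjection F := by
  refine ContinuousLinearMap.ext fun f => ?_
  change G.kernelProjection F (G.kernelProjection F f) = _
  rw [kernelProjection_apply, G.kernelProjection_apply F f]
  refine Finset.sum_congr rfl fun R _ => ?_
  rw [← kernelProjection_apply, G.inner_leftVector_kernelProjection hF]

theorem outLaplacianOn_mul_kernelProjection :
    G.outLaplacianOn F * G.kernelProjection F = 0 := by
  refine ContinuousLinearMap.ext fun f => ?_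
  change G.outLaplacianOn F (G.kernelProjection F f) = 0
  rw [kernelProjection_apply, map_sum]
  exact Finset.sum_eq_zero fun R _ => by rw [map_smul, outLaplacianOn_rightVector, smul_zero]

theorem kernelProjection_mul_outLaplacianOn (hF : F ⊆ G.edges) :
    G.kernelProjection F * G.outLaplacianOn F = 0 := by
  refine ContinuousLinearMap.ext fun f => ?_
  change G.kernelProjection F (G.outLaplacianOn F f) = 0
  rw [kernelProjection_apply]
  exact Finset.sum_eq_zero fun R _ => by rw [G.inner_leftVector_outLaplacianOn hF, zero_smul]

theorem exists_one_sub_kernelProjection_eq (hF : F ⊆ G.edges) :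
    ∃ Z : G.Ell2 →L[ℂ] G.Ell2, 1 - G.kernelProjection F = G.outLaplacianOn F * Z := by
  have hmem : ∀ f, ((1 - G.kernelProjection F : G.Ell2 →L[ℂ] G.Ell2) : G.Ell2 →ₗ[ℂ] G.Ell2) f ∈
      LinearMap.range (G.outLaplacianOn F : G.Ell2 →ₗ[ℂ] G.Ell2) := by
    intro f
    refine G.mem_range_outLaplacianOn hF fun R => ?_
    change inner ℂ _ (f - G.kernelProjection F f) = 0
    rw [inner_sub_right, G.inner_leftVector_kernelProjection hF, sub_self]
  -- `1 - P` takes values in the range of `L⁺_F`, and any linear choice of preimages gives `Z`.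
  obtain ⟨Z, hZ⟩ := Module.projective_lifting_property
    (G.outLaplacianOn F : G.Ell2 →ₗ[ℂ] G.Ell2).rangeRestrict
    (LinearMap.codRestrict _ _ hmem) (LinearMap.surjective_rangeRestrict _)
  refine ⟨LinearMap.toContinuousLinearMap Z, ContinuousLinearMap.ext fun f => ?_⟩
  exact (congrArg Subtype.val (LinearMap.congr_fun hZ f)).symm

theorem rieszProjection_outLaplacianOn (hF : F ⊆ G.edges) :
    rieszProjection (G.outLaplacianOn F) = G.kernelProjection F := by
  obtain ⟨Z, hZ⟩ := G.exists_one_sub_kernelProjection_eq hF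
  exact rieszProjection_eq (G.kernelProjection_mul_self hF) G.outLaplacianOn_mul_kernelProjection
    (G.kernelProjection_mul_outLaplacianOn hF) hZ

/-! ### The reduced graph -/

theorem inner_chi_rightVector_self (hF : F ⊆ G.edges) (R : Reach (transposeEdges F)) :
    inner ℂ (G.chi R.1) (G.rightVector F R) = 1 := by
  rw [← G.inner_leftVector_rightVector_self hF R, inner_def, inner_def]
  refine Finset.sum_congr rfl fun x _ => ?_
  change (starRingEnd ℂ) (Set.indicator R.1 (fun _ => (1 : ℂ)) x) * (G.gammaRight F R x : ℂ) * _ =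
    (starRingEnd ℂ) (G.gammaLeft F R x : ℂ) * (G.gammaRight F R x : ℂ) * _
  by_cases h : G.gammaRight F R x = 0
  · rw [h]
    simp
  · have hr := G.isRoot_of_gammaRight_ne_zero h
    rw [Set.indicator_of_mem hr.mem, G.gammaLeft_of_isRoot hr, Complex.ofReal_one]

theorem inner_chi_rightVector_of_ne {R S : Reach (transposeEdges F)} (hne : R ≠ S) :
    inner ℂ (G.chi R.1) (G.rightVector F S) = 0 := by
  rw [inner_def]
  refine Finset.sum_eq_zero fun x _ => ?_
  change (starRingEnd ℂ) (Set.indicator R.1 (fun _ => (1 : ℂ)) x) * (G.gammaRight F S x : ℂ) * _ = 0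
  by_cases h : G.gammaRight F S x = 0
  · rw [h]
    simp
  · have hr := G.isRoot_of_gammaRight_ne_zero h
    rw [Set.indicator_of_notMem fun hx => hne (hr.eq_of_mem hx)]
    simp

/-- In the expansion of `P⁺ χ_R`, pairing with `χ_R` keeps only the term of `R`, because roots of
other reaches lie outside `R`. -/
theorem reducedMass_eq (hF : F ⊆ G.edges) (R : Reach (transposeEdges F)) :
    G.reducedMass F R = ∑ x, G.m x * G.gammaLeft F R x := by
  have h : inner ℂ (G.leftVector F R) (G.chi R.1) =
      ((∑ x, G.m x * G.gammaLeft F R x : ℝ) : ℂ) := by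
    rw [inner_def, Complex.ofReal_sum]
    refine Finset.sum_congr rfl fun x _ => ?_
    change (starRingEnd ℂ) (G.gammaLeft F R x : ℂ) *
      (Set.indicator R.1 (fun _ => (1 : ℂ)) x) * _ = _
    by_cases hx : x ∈ R.1
    · rw [Set.indicator_of_mem hx, Complex.conj_ofReal]
      push_cast
      ring
    · rw [Set.indicator_of_notMem hx, G.gammaLeft_of_notMem hx]
      simp
  rw [reducedMass, G.rieszProjection_outLaplacianOn hF, kernelProjection_apply, inner_sum,
    Finset.sum_eq_single R]
  · rw [inner_smul_right, G.inner_chi_rightVector_self hF, mul_one, h, Complex.ofReal_re]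
  · intro S _ hS
    rw [inner_smul_right, G.inner_chi_rightVector_of_ne hS.symm, mul_zero]
  · exact fun h => absurd (Finset.mem_univ R) h

theorem reducedMass_pos (hF : F ⊆ G.edges) (R : Reach (transposeEdges F)) :
    0 < G.reducedMass F R := by
  rw [G.reducedMass_eq hF]
  refine Finset.sum_pos' (fun x _ => mul_nonneg (G.m_pos x).le (G.gammaLeft_nonneg hF R x))
    ⟨R.root, Finset.mem_univ _, ?_⟩
  rw [G.gammaLeft_of_isRoot R.isRoot_root, mul_one]
  exact G.m_pos _

variable (F) in
/-- The weight of the edges of `G` between two reaches, seen through the kernel vectors. -/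
noncomputable def transferWeight (R S : Reach (transposeEdges F)) : ℝ :=
  ∑ r, ∑ s, G.gammaLeft F R r * G.a r s * G.gammaRight F S s

theorem reducedWeight_eq (R S : Reach (transposeEdges F)) :
    G.reducedWeight F R S = G.transferWeight F R S * G.reducedMass F S := by
  classical
  rw [reducedWeight, transferWeight]
  congr 1
  have h1 : ∀ r, ∑ s with s ∈ S.1, G.gammaLeft F R r * G.a r s * G.gammaRight F S s =
      ∑ s, G.gammaLeft F R r * G.a r s * G.gammaRight F S s := fun r =>
    Finset.sum_filter_of_ne fun s _ hs =>
      (G.isRoot_of_gammaRight_ne_zero (right_ne_zero_of_mul hs)).mem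
  have h2 : ∑ r with r ∈ R.1, ∑ s, G.gammaLeft F R r * G.a r s * G.gammaRight F S s =
      ∑ r, ∑ s, G.gammaLeft F R r * G.a r s * G.gammaRight F S s := by
    refine Finset.sum_filter_of_ne fun r _ hr => ?_
    by_contra hn
    exact hr (Finset.sum_eq_zero fun s _ => by rw [G.gammaLeft_of_notMem hn, zero_mul, zero_mul])
  rw [← h2]
  refine Finset.sum_congr (by ext; simp) fun r _ => ?_
  rw [← h1]

theorem reducedWeight_nonneg (hF : F ⊆ G.edges) (R S : Reach (transposeEdges F)) :
    0 ≤ G.reducedWeight F R S := by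
  rw [reducedWeight_eq]
  refine mul_nonneg (Finset.sum_nonneg fun r _ => Finset.sum_nonneg fun s _ => ?_)
    (G.reducedMass_pos hF S).le
  exact mul_nonneg (mul_nonneg (G.gammaLeft_nonneg hF R r) (G.a_nonneg r s))
    (G.gammaRight_nonneg hF S s)

/-- Since the `gammaLeft` sum to `1`, the total transfer out of `S` is the mean out-degree under
`gammaRight S`. This makes the compression a Laplacian. -/
theorem sum_transferWeight (hF : F ⊆ G.edges) (S : Reach (transposeEdges F)) :
    ∑ R, G.transferWeight F R S = ∑ s, ∑ r, G.a r s * G.gammaRight F S s := by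
  simp only [transferWeight]
  rw [Finset.sum_comm]
  conv_rhs => rw [Finset.sum_comm]
  refine Finset.sum_congr rfl fun r _ => ?_
  rw [Finset.sum_comm]
  refine Finset.sum_congr rfl fun s _ => ?_
  rw [← Finset.sum_mul, ← Finset.sum_mul, G.sum_gammaLeft hF, one_mul]

theorem outLaplacianOn_diff_add :
    G.outLaplacianOn (G.edges \ F) + G.outLaplacianOn F = G.outLaplacian := by
  have h := G.outLaplacianWith_add_smul (G.restrictWeight (G.edges \ F)) (G.restrictWeight F) 1
  rw [Complex.ofReal_one, one_smul] at h
  refine h.trans (congrArg G.outLaplacianWith ?_)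
  funext x y
  unfold restrictWeight
  by_cases h1 : (x, y) ∈ F
  · simp [h1]
  · by_cases h2 : (x, y) ∈ G.edges
    · simp [h1, h2]
    · have h3 : G.a x y = 0 := le_antisymm (not_lt.1 h2) (G.a_nonneg x y)
      simp [h1, h2, h3]

theorem inner_leftVector_outLaplacian_rightVector (R S : Reach (transposeEdges F)) :
    inner ℂ (G.leftVector F R) (G.outLaplacian (G.rightVector F S)) =
      ((∑ s, G.gammaLeft F R s * ∑ r, G.a r s * G.gammaRight F S s : ℝ) : ℂ) -
        (G.transferWeight F R S : ℂ) := by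
  rw [outLaplacian, inner_outLaplacianWith, transferWeight, Finset.sum_comm, ← Complex.ofReal_sub,
    ← Finset.sum_sub_distrib, Complex.ofReal_sum]
  refine Finset.sum_congr rfl fun y _ => ?_
  rw [Finset.mul_sum, ← Finset.sum_sub_distrib, Finset.sum_mul, Complex.ofReal_sum]
  refine Finset.sum_congr rfl fun x _ => ?_
  change (G.a x y : ℂ) * (starRingEnd ℂ) ((G.gammaLeft F R y : ℂ) - (G.gammaLeft F R x : ℂ)) *
    (G.gammaRight F S y : ℂ) = _
  rw [map_sub, Complex.conj_ofReal, Complex.conj_ofReal]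
  push_cast
  ring

theorem inner_leftVector_outLaplacian_rightVector_self (hF : F ⊆ G.edges)
    (R : Reach (transposeEdges F)) :
    inner ℂ (G.leftVector F R) (G.outLaplacian (G.rightVector F R)) =
      ((∑ S, G.transferWeight F S R : ℝ) : ℂ) - (G.transferWeight F R R : ℂ) := by
  rw [inner_leftVector_outLaplacian_rightVector, G.sum_transferWeight hF]
  congr 2
  refine Finset.sum_congr rfl fun s _ => ?_
  rw [Finset.mul_sum]
  refine Finset.sum_congr rfl fun r _ => ?_
  rw [mul_left_comm, gammaLeft_mul_gammaRight_self]

theorem inner_leftVector_outLaplacian_rightVector_of_ne {R S : Reach (transposeEdges F)}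
    (hne : R ≠ S) :
    inner ℂ (G.leftVector F R) (G.outLaplacian (G.rightVector F S)) =
      -(G.transferWeight F R S : ℂ) := by
  rw [inner_leftVector_outLaplacian_rightVector, sub_eq_neg_self, Complex.ofReal_eq_zero]
  refine Finset.sum_eq_zero fun s _ => ?_
  rw [Finset.mul_sum]
  refine Finset.sum_eq_zero fun r _ => ?_
  rw [mul_left_comm, G.gammaLeft_mul_gammaRight_of_ne hne, mul_zero]

variable (hm : ∀ R, 0 < G.reducedMass F R) (ha : ∀ R S, 0 ≤ G.reducedWeight F R S)

theorem interpolateUp_apply (f : (G.reducedGraph F hm ha).Ell2) :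
    G.interpolateUp F hm ha f = ∑ R, ((G.reducedMass F R : ℂ) * f R) • G.rightVector F R := by
  refine Eq.symm ?_
  refine funext fun v => ?_
  exact Finset.sum_apply (M := fun _ : V => ℂ) v _ _

theorem projectDown_apply (f : G.Ell2) (R : Reach (transposeEdges F)) :
    G.projectDown F hm ha f R = inner ℂ (G.leftVector F R) f / (G.reducedMass F R : ℂ) := rfl

theorem interpolateUp_comp_projectDown :
    (G.interpolateUp F hm ha).comp (G.projectDown F hm ha) = G.kernelProjection F := by
  refine ContinuousLinearMap.ext fun f => ?_
  change G.interpolateUp F hm ha (G.projectDown F hm ha f) = _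
  rw [interpolateUp_apply, kernelProjection_apply]
  refine Finset.sum_congr rfl fun R _ => ?_
  rw [projectDown_apply, mul_div_cancel₀ _ (Complex.ofReal_ne_zero.2 (hm R).ne')]

theorem outLaplacianOn_comp_interpolateUp :
    (G.outLaplacianOn F).comp (G.interpolateUp F hm ha) = 0 := by
  refine ContinuousLinearMap.ext fun f => ?_
  change G.outLaplacianOn F (G.interpolateUp F hm ha f) = 0
  rw [interpolateUp_apply, map_sum]
  exact Finset.sum_eq_zero fun R _ => by rw [map_smul, outLaplacianOn_rightVector, smul_zero]

/-- The reduced Laplacian is the compression of the Laplacian of the uncoupled edges. -/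
theorem projectDown_comp_outLaplacianOn_comp_interpolateUp (hF : F ⊆ G.edges) :
    (G.projectDown F hm ha).comp ((G.outLaplacianOn (G.edges \ F)).comp (G.interpolateUp F hm ha)) =
      (G.reducedGraph F hm ha).outLaplacian := by
  classical
  refine ContinuousLinearMap.ext fun f => funext fun R => ?_
  -- `L⁺_F` kills the range of `J⁺↑`, so the full Laplacian may be used. This matches the reduced
  -- weights, which involve all of `a` and not only the edges outside `F`.
  have hup : G.outLaplacianOn (G.edges \ F) (G.interpolateUp F hm ha f) =
      G.outLaplacian (G.interpolateUp F hm ha f) := by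
    rw [← G.outLaplacianOn_diff_add (F := F)]
    have h0 : G.outLaplacianOn F (G.interpolateUp F hm ha f) = 0 :=
      congrArg (fun T : _ →L[ℂ] G.Ell2 => T f) (G.outLaplacianOn_comp_interpolateUp hm ha)
    rw [add_apply, h0, add_zero]
  change G.projectDown F hm ha (G.outLaplacianOn (G.edges \ F) (G.interpolateUp F hm ha f)) R =
    (1 / (G.reducedMass F R : ℂ)) * ((∑ S, (G.reducedWeight F S R : ℂ)) * f R -
      ∑ S, (G.reducedWeight F R S : ℂ) * f S)
  rw [hup, projectDown_apply, div_eq_mul_one_div, mul_comm]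
  congr 1
  have h1 : ∀ S, inner ℂ (G.leftVector F R) (G.outLaplacian (G.rightVector F S)) =
      (if R = S then ((∑ T, G.transferWeight F T R : ℝ) : ℂ) else 0) -
        (G.transferWeight F R S : ℂ) := by
    intro S
    split_ifs with h
    · subst h
      exact G.inner_leftVector_outLaplacian_rightVector_self hF R
    · rw [G.inner_leftVector_outLaplacian_rightVector_of_ne h, zero_sub]
  rw [interpolateUp_apply, map_sum, inner_sum]
  simp only [map_smul, inner_smul_right, h1, mul_sub, Finset.sum_sub_distrib, mul_ite, mul_zero,
    Finset.sum_ite_eq, Finset.mem_univ, if_true, reducedWeight_eq]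
  congr 1
  · push_cast
    rw [← Finset.sum_mul]
    ring
  · refine Finset.sum_congr rfl fun S _ => ?_
    push_cast
    ring

end WeightedDigraph

theorem mainTheorem7 {V : Type*} [Fintype V] (G : WeightedDigraph V) (F : Set (V × V))
    (hF : F ⊆ G.edges) :
    ∃ (hm : ∀ R, 0 < G.reducedMass F R) (ha : ∀ R S, 0 ≤ G.reducedWeight F R S),
      ∀ t : ℝ, 0 < t →
        Tendsto
          (fun β : ℝ =>
            ‖NormedSpace.exp (-(t : ℂ) • G.outLaplacianCoupled F β) -
              (G.interpolateUp F hm ha).comp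
                ((NormedSpace.exp (-(t : ℂ) • (G.reducedGraph F hm ha).outLaplacian)).comp
                  (G.projectDown F hm ha))‖)
          atTop (𝓝 0) := by
  refine ⟨G.reducedMass_pos hF, G.reducedWeight_nonneg hF, fun t ht => ?_⟩
  have : CompleteSpace G.Ell2 := FiniteDimensional.complete ℂ _
  have : CompleteSpace
      (G.reducedGraph F (G.reducedMass_pos hF) (G.reducedWeight_nonneg hF)).Ell2 :=
    FiniteDimensional.complete ℂ _
  obtain ⟨C, c, hc, hK⟩ := G.exists_powerBounded F
  obtain ⟨Z, hZ⟩ := G.exists_one_sub_kernelProjection_eq hF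
  have h := tendsto_exp_strong_coupling (G.outLaplacianOn (G.edges \ F)) (G.outLaplacianOn F) Z
    (G.interpolateUp F (G.reducedMass_pos hF) (G.reducedWeight_nonneg hF))
    (G.projectDown F (G.reducedMass_pos hF) (G.reducedWeight_nonneg hF))
    (G.outLaplacianOn_comp_interpolateUp _ _)
    (by rw [G.interpolateUp_comp_projectDown, hZ]) hc hK ht
  rw [G.projectDown_comp_outLaplacianOn_comp_interpolateUp _ _ hF] at h
  exact h
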